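/- Fix the scalar field $\mathbb{K}=\mathbb{R}$ or $\mathbb{K}=\mathbb{C}$. For an infinite cardinal $\lambda$ let $c_0(\lambda)$ be the space of functions $f\colon\lambda\to\mathbb{K}$ such that $\{\alpha<\lambda\colon |f(\alpha)|\geqslant\varepsilon\}$ is finite for every $\varepsilon>0$, and let $\ell_\infty^c(\lambda)$ be the space of bounded functions $f\colon\lambda\to\mathbb{K}$ such that $f(\alpha)\neq 0$ for at most countably many $\alpha<\lambda$; both carry the supremum norm, and $\ell_p(\lambda)$ ($p\in[1,\infty]$) carries its usual norm. For a Banach space $X$ let $\mathscr{B}(X)$ be the Banach algebra of bounded linear operators on $X$. For Banach spaces $E$ and $X$ let $\mathscr{S}_E(X)$ be the set of those $T\in\mathscr{B}(X)$ for which there is no pair of a subspace $E_0\subseteq X$ isomorphic (linearly homeomorphic) to $E$ and a constant $c>0$ such that $\|Tx\|\geqslant c\|x\|$ for all $x\in E_0$. Theorem. Let $\kappa$ and $\lambda$ be infinite cardinals and let $p\in[1,\infty]$. Then (1) $\mathscr{S}_{c_0(\kappa)}(c_0(\lambda))$ is a norm-closed two-sided ideal of $\mathscr{B}(c_0(\lambda))$;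 (2) $\mathscr{S}_{\ell_p(\kappa)}(\ell_p(\lambda))$ is a norm-closed two-sided ideal of $\mathscr{B}(\ell_p(\lambda))$; (3) $\mathscr{S}_{\ell_\infty^c(\kappa)}(\ell_\infty^c(\lambda))$ is a norm-closed two-sided ideal of $\mathscr{B}(\ell_\infty^c(\lambda))$. (The ideals need not be proper.) Moreover, $$\mathscr{S}_{\ell_\infty^c(\kappa)}(\ell_\infty^c(\lambda)) = \mathscr{S}_{c_0(\kappa)}(\ell_\infty^c(\lambda)).$$ -/

import Mathlib

open Filter Topology
open scoped ENNReal

noncomputable section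

/-- The Banach space `c₀(Γ)` of scalar functions on the set `Γ` that tend to zero along the
complements of finite sets, a subspace of `ℓ_∞(Γ)` with the supremum norm. -/
def c0Space (𝕜 : Type*) [RCLike 𝕜] (Γ : Type*) : Submodule 𝕜 (lp (fun _ : Γ => 𝕜) ∞) where
  carrier := {f | Tendsto (fun γ => f γ) cofinite (𝓝 0)}
  zero_mem' := by
    simpa using (tendsto_const_nhds : Tendsto (fun _ : Γ => (0 : 𝕜)) cofinite (𝓝 0))
  add_mem' := by
    intro f g hf hg
    simpa using hf.add hg
  smul_mem' := by
    intro c f hf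
    simpa using hf.const_mul c

/-- The Banach space `ℓ_∞^c(Γ)` of bounded scalar functions on `Γ` with countable support,
a subspace of `ℓ_∞(Γ)` with the supremum norm. -/
def linftyc (𝕜 : Type*) [RCLike 𝕜] (Γ : Type*) : Submodule 𝕜 (lp (fun _ : Γ => 𝕜) ∞) where
  carrier := {f | {γ | f γ ≠ 0}.Countable}
  zero_mem' := by simp
  add_mem' := by
    intro f g hf hg
    refine (Set.Countable.union hf hg).mono ?_
    intro γ hγ
    by_contra h
    simp only [Set.mem_union, Set.mem_ofPred_eq, not_or, not_not] at h
    exact hγ (by simp [h.1, h.2])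
  smul_mem' := by
    intro c f hf
    refine Set.Countable.mono ?_ hf
    intro γ hγ h
    exact hγ (by simp [h])

section Operators

variable {𝕜 : Type*} [RCLike 𝕜]
  {X : Type*} [NormedAddCommGroup X] [NormedSpace 𝕜 X]
  {Y : Type*} [NormedAddCommGroup Y] [NormedSpace 𝕜 Y]

/-- `T` is bounded below on a copy of `E`: the domain of `T` has a subspace `E₀` that is
(linearly homeomorphically) isomorphic to `E` and on which `‖T x‖ ≥ c ‖x‖` for some `c > 0`. -/
def BoundedBelowOnCopy (E : Type*) [NormedAddCommGroup E] [NormedSpace 𝕜 E] (T : X →L[𝕜] Y) :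
    Prop :=
  ∃ E₀ : Submodule 𝕜 X, Nonempty (E₀ ≃L[𝕜] E) ∧ ∃ c : ℝ, 0 < c ∧ ∀ x ∈ E₀, c * ‖x‖ ≤ ‖T x‖

variable (𝕜) in
/-- `𝒮_E(X)`: the bounded operators on `X` that are not bounded below on any copy of `E`. -/
def singularOps (E : Type*) [NormedAddCommGroup E] [NormedSpace 𝕜 E]
    (X : Type*) [NormedAddCommGroup X] [NormedSpace 𝕜 X] : Set (X →L[𝕜] X) :=
  {T | ¬ BoundedBelowOnCopy E T}

/-- A norm-closed (two-sided, not necessarily proper) ideal of the Banach algebra `ℬ(X)`.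
As `ℬ(X)` is unital, a two-sided ring ideal is automatically a linear subspace. -/
def IsClosedIdeal (A : Set (X →L[𝕜] X)) : Prop :=
  (∃ I : TwoSidedIdeal (X →L[𝕜] X), (I : Set (X →L[𝕜] X)) = A) ∧ IsClosed A

end Operators

end

/-! ### Operators bounded below on a copy of a space -/

section Operators

variable {𝕜 : Type*} [RCLike 𝕜]
  {E : Type*} [NormedAddCommGroup E] [NormedSpace 𝕜 E]
  {X : Type*} [NormedAddCommGroup X] [NormedSpace 𝕜 X]
  {Y : Type*} [NormedAddCommGroup Y] [NormedSpace 𝕜 Y]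
  {Z : Type*} [NormedAddCommGroup Z] [NormedSpace 𝕜 Z]

/-! An operator `T` is bounded below on a copy of `E` exactly when some bounded `J` from `E` makes
`T ∘ J` bounded below. In this form closedness and stability under composition are soft. The content
is additivity: if `A + B` is bounded below on `E`, then `A` or `B` must be bounded below on a copy
of `E`.

For the sup-norm spaces this follows from Rosenthal's theorem
(`IsPermutable.exists_injective_le_norm`): if `‖T e_k‖ ≥ δ` for every unit vector, then `T` is
bounded below on the vectors supported in some index set of full cardinality. If `A + B` is bounded
below by `c`, one summand has norm at least `c / 2` on full-cardinality many unit vectors. The same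
theorem gives the final equality: an operator from `c₀(K)` into `ℓ_∞^c(L)` is a matrix with
uniformly summable rows, so some operator on `ℓ_∞^c(K)` has the same values on unit vectors, and
only those values matter.

For `p < ∞`, combine `A` and `B` into one operator `T = (A, B)` into `ℓ_p(L ⊕ L)`. Images of unit
vectors may overlap, but by pigeonhole two of them nearly agree on the coordinates already used, so
their difference has an image nearly supported elsewhere. Transfinite recursion gives
full-cardinality many differences with nearly disjointly supported images under `T`, hence under `A`
and `B` at once (`lp.exists_nearly_disjoint`). One summand has norm at least `c / 2` on
full-cardinality many of these, and nearly disjoint images of norm at least `c / 2` span `ℓ_p` from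
below. -/

theorem exists_pos_le_norm_of_comp {ι : Type*} [Norm ι] (J : X →L[𝕜] Y) (T : Y →L[𝕜] Z)
    {f : ι → X} {c : ℝ}
    (hc : 0 < c) (h : ∀ x, c * ‖x‖ ≤ ‖T (J (f x))‖) :
    ∃ d : ℝ, 0 < d ∧ ∀ x, d * ‖x‖ ≤ ‖J (f x)‖ := by
  refine ⟨c / (‖T‖ + 1), by positivity, fun x => ?_⟩
  have h1 : c * ‖x‖ ≤ (‖T‖ + 1) * ‖J (f x)‖ :=
    (h x).trans ((T.le_opNorm _).trans (by gcongr; linarith))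
  rw [div_mul_eq_mul_div, div_le_iff₀ (by positivity)]
  linarith

/-- The lower bound for `T ∘ J` forces one for `J`, so `J` is an embedding and its range is the
required copy. -/
theorem boundedBelowOnCopy_of_comp (J : E →L[𝕜] X) (T : X →L[𝕜] Y) {c : ℝ} (hc : 0 < c)
    (h : ∀ x, c * ‖x‖ ≤ ‖T (J x)‖) : BoundedBelowOnCopy (𝕜 := 𝕜) E T := by
  obtain ⟨d, hd, hJ⟩ := exists_pos_le_norm_of_comp J T (f := id) hc h
  have hinj : Function.Injective J := by
    rw [injective_iff_map_eq_zero]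
    intro x hx
    have := hJ x
    simp only [id, hx, norm_zero] at this
    have h3 : ‖x‖ ≤ 0 := by
      by_contra! h4
      nlinarith
    simpa using h3
  let e : E ≃ₗ[𝕜] LinearMap.range (J : E →ₗ[𝕜] X) := LinearEquiv.ofInjective (J : E →ₗ[𝕜] X) hinj
  have he : ∀ x, ((e x : LinearMap.range (J : E →ₗ[𝕜] X)) : X) = J x := fun x => rfl
  refine ⟨LinearMap.range (J : E →ₗ[𝕜] X),
    ⟨(e.toContinuousLinearEquivOfBounds ‖J‖ d⁻¹ (fun x => ?_) (fun y => ?_)).symm⟩,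
    c / (‖J‖ + 1), by positivity, ?_⟩
  · change ‖((e x : LinearMap.range (J : E →ₗ[𝕜] X)) : X)‖ ≤ _
    rw [he]
    exact J.le_opNorm x
  · obtain ⟨x, rfl⟩ := e.surjective y
    rw [e.symm_apply_apply]
    change _ ≤ _ * ‖((e x : LinearMap.range (J : E →ₗ[𝕜] X)) : X)‖
    rw [he, le_inv_mul_iff₀ hd]
    exact hJ x
  · rintro _ ⟨x, rfl⟩
    refine le_trans ?_ (h x)
    have h1 : ‖J x‖ ≤ (‖J‖ + 1) * ‖x‖ := (J.le_opNorm x).trans (by gcongr; linarith)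
    rw [div_mul_eq_mul_div, div_le_iff₀ (by positivity)]
    calc c * ‖J x‖ ≤ c * ((‖J‖ + 1) * ‖x‖) := by gcongr
      _ = _ := by ring

theorem BoundedBelowOnCopy.exists_comp {T : X →L[𝕜] Y} (h : BoundedBelowOnCopy (𝕜 := 𝕜) E T) :
    ∃ (J : E →L[𝕜] X) (c : ℝ), 0 < c ∧ ∀ x, c * ‖x‖ ≤ ‖T (J x)‖ := by
  obtain ⟨E₀, ⟨e⟩, c, hc, h⟩ := h
  refine ⟨E₀.subtypeL.comp (e.symm : E →L[𝕜] E₀), c / (‖(e : E₀ →L[𝕜] E)‖ + 1), by positivity,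
    fun x => ?_⟩
  refine le_trans ?_ (h _ (e.symm x).2)
  have h1 : ‖x‖ ≤ (‖(e : E₀ →L[𝕜] E)‖ + 1) * ‖e.symm x‖ := by
    calc ‖x‖ = ‖(e : E₀ →L[𝕜] E) (e.symm x)‖ := by simp
      _ ≤ _ := ((e : E₀ →L[𝕜] E).le_opNorm _).trans (by gcongr; linarith)
  rw [div_mul_eq_mul_div, div_le_iff₀ (by positivity)]
  calc c * ‖x‖ ≤ c * ((‖(e : E₀ →L[𝕜] E)‖ + 1) * ‖e.symm x‖) := by gcongr
    _ = c * ‖((e.symm x : E₀) : X)‖ * (‖(e : E₀ →L[𝕜] E)‖ + 1) := by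
      rw [Submodule.coe_norm]; ring

theorem boundedBelowOnCopy_comp_of_exists {F : Type*} [NormedAddCommGroup F] [NormedSpace 𝕜 F]
    {T : X →L[𝕜] Y} (h : BoundedBelowOnCopy (𝕜 := 𝕜) E T) (i : F →L[𝕜] E) {a : ℝ} (ha : 0 < a)
    (hi : ∀ x, a * ‖x‖ ≤ ‖i x‖) : BoundedBelowOnCopy (𝕜 := 𝕜) F T := by
  obtain ⟨J, c, hc, hJ⟩ := h.exists_comp
  refine boundedBelowOnCopy_of_comp (J.comp i) T (mul_pos hc ha) fun x => ?_
  calc c * a * ‖x‖ = c * (a * ‖x‖) := by ring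
    _ ≤ c * ‖i x‖ := by gcongr; exact hi x
    _ ≤ _ := hJ (i x)

/-- The singular operators form a closed ideal once sums of two operators into `X` that are
bounded below on `E` force one of the summands to be bounded below on a copy of `E`. -/
theorem isClosedIdeal_singularOps [Nontrivial E]
    (hadd : ∀ (A B : E →L[𝕜] X) (c : ℝ), 0 < c → (∀ x, c * ‖x‖ ≤ ‖A x + B x‖) →
      BoundedBelowOnCopy (𝕜 := 𝕜) E A ∨ BoundedBelowOnCopy (𝕜 := 𝕜) E B) :
    IsClosedIdeal (singularOps 𝕜 E X) := by
  refine ⟨⟨TwoSidedIdeal.mk' (singularOps 𝕜 E X) ?_ ?_ ?_ ?_ ?_, TwoSidedIdeal.coe_mk' ..⟩, ?_⟩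
  · intro h
    obtain ⟨J, c, hc, h⟩ := h.exists_comp
    obtain ⟨x, hx⟩ := exists_ne (0 : E)
    have h1 := h x
    have h2 : 0 < ‖x‖ := norm_pos_iff.2 hx
    simp only [zero_apply, norm_zero] at h1
    nlinarith
  · intro A B hA hB h
    obtain ⟨J, c, hc, h⟩ := h.exists_comp
    rcases hadd (A.comp J) (B.comp J) c hc (fun x => h x) with h | h
    · obtain ⟨J', c', hc', h⟩ := h.exists_comp
      exact hA (boundedBelowOnCopy_of_comp (J.comp J') A hc' h)
    · obtain ⟨J', c', hc', h⟩ := h.exists_comp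
      exact hB (boundedBelowOnCopy_of_comp (J.comp J') B hc' h)
  · intro A hA h
    obtain ⟨J, c, hc, h⟩ := h.exists_comp
    exact hA (boundedBelowOnCopy_of_comp J A hc (by simpa using h))
  · intro A B hB h
    obtain ⟨J, c, hc, h⟩ := h.exists_comp
    obtain ⟨d, hd, h'⟩ := exists_pos_le_norm_of_comp B A (f := J) hc h
    exact hB (boundedBelowOnCopy_of_comp J B hd h')
  · intro A B hA h
    obtain ⟨J, c, hc, h⟩ := h.exists_comp
    exact hA (boundedBelowOnCopy_of_comp (B.comp J) A hc h)
  -- Within distance `c / 2` of `T`, the same copy works with constant `c / 2`.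
  · rw [← isOpen_compl_iff, Metric.isOpen_iff]
    intro T hT
    have hT' : BoundedBelowOnCopy (𝕜 := 𝕜) E T := not_not.1 hT
    obtain ⟨E₀, e, c, hc, h⟩ := hT'
    refine ⟨c / 2, by positivity, fun S hS => not_not.2 ⟨E₀, e, c / 2, by positivity, fun x hx => ?_⟩⟩
    rw [Metric.mem_ball, dist_eq_norm, norm_sub_rev] at hS
    have h1 : ‖T x - S x‖ ≤ c / 2 * ‖x‖ :=
      ((T - S).le_opNorm x).trans (by gcongr)
    have h2 := norm_sub_norm_le (T x) (S x)
    have h3 := h x hx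
    linarith

end Operators

/-! ### Combinatorics of infinite index sets -/

section Combinatorics

open Cardinal

universe u

/-- An infinite cardinal is not the sum of two smaller ones, so one of the two sets has full
cardinality. -/
theorem exists_injective_forall_or {K : Type u} [Infinite K] {P Q : K → Prop}
    (h : ∀ k, P k ∨ Q k) :
    ∃ g : K → K, Function.Injective g ∧ ((∀ k, P (g k)) ∨ ∀ k, Q (g k)) := by
  have key : ∀ R : K → Prop, #K ≤ #{k | R k} →
      ∃ g : K → K, Function.Injective g ∧ ∀ k, R (g k) := by
    intro R hR
    obtain ⟨f⟩ := hR
    exact ⟨fun k => (f k).1, Subtype.val_injective.comp f.injective, fun k => (f k).2⟩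
  by_cases hP : #K ≤ #{k | P k}
  · obtain ⟨g, hg, h⟩ := key P hP
    exact ⟨g, hg, Or.inl h⟩
  by_cases hQ : #K ≤ #{k | Q k}
  · obtain ⟨g, hg, h⟩ := key Q hQ
    exact ⟨g, hg, Or.inr h⟩
  · exfalso
    have h1 : (Set.univ : Set K) = {k | P k} ∪ {k | Q k} := by
      ext k; simpa using h k
    have h2 : #K ≤ #{k | P k} + #{k | Q k} := by
      rw [← mk_univ (α := K), h1]
      exact mk_union_le _ _
    exact absurd h2 (not_le.2 (add_lt_of_lt (aleph0_le_mk K) (not_le.1 hP) (not_le.1 hQ)))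

/-- Rosenthal's disjointness lemma for superadditive set functions. -/
theorem exists_injective_superadditive_le {K : Type u} [Infinite K] (v : K → Set K → ℝ)
    (h0 : ∀ k S, 0 ≤ v k S)
    (hadd : ∀ k S S', Disjoint S S' → v k S + v k S' ≤ v k (S ∪ S'))
    {M : ℝ} (hM : ∀ k, v k Set.univ ≤ M) {ε : ℝ} (hε : 0 < ε) :
    ∃ g : K → K, Function.Injective g ∧ ∀ i, v (g i) (Set.range g \ {g i}) ≤ ε := by
  have hmono : ∀ k S S', S ⊆ S' → v k S ≤ v k S' := by
    intro k S S' h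
    have := hadd k S (S' \ S) Set.disjoint_sdiff_right
    rw [Set.union_sdiff_cancel h] at this
    linarith [h0 k (S' \ S)]
  -- Induction on how many times `ε` fits into the bound: each failure to find a good subfamily
  -- lowers the bound by `ε`.
  have step : ∀ (n : ℕ) (f : K → K), Function.Injective f →
      (∀ i, v (f i) (Set.range f) ≤ n * ε) →
      ∃ g : K → K, Function.Injective g ∧ ∀ i, v (g i) (Set.range g \ {g i}) ≤ ε := by
    intro n
    induction n with
    | zero =>
      intro f hf h
      refine ⟨f, hf, fun i => (hmono _ _ _ Set.sdiff_subset).trans ((h i).trans ?_)⟩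
      simpa using hε.le
    | succ n ih =>
      intro f hf h
      -- Split the family into `#K` rows of size `#K`. Either some row is already good, or each row
      -- `i` has a bad member `j i`. In the latter case the bad members form the new family: the
      -- rest of row `i` carries more than `ε`, which superadditivity takes away from the bound.
      obtain ⟨e⟩ : Nonempty (K × K ≃ K) := by
        rw [← Cardinal.eq, mk_prod, lift_id, mul_eq_self (aleph0_le_mk K)]
      by_cases hgood : ∃ i, ∀ j, v (f (e (i, j)))
          (Set.range (fun j => f (e (i, j))) \ {f (e (i, j))}) ≤ ε
      · obtain ⟨i, hi⟩ := hgood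
        refine ⟨fun j => f (e (i, j)), fun a b hab => ?_, hi⟩
        simpa using e.injective (hf hab)
      · push Not at hgood
        choose j hj using hgood
        have hinj : Function.Injective fun i => f (e (i, j i)) := fun a b hab => by
          have := e.injective (hf hab)
          exact (Prod.ext_iff.1 this).1
        refine ih (fun i => f (e (i, j i))) hinj fun i => ?_
        have hd : Disjoint (Set.range fun i => f (e (i, j i)))
            (Set.range (fun j => f (e (i, j))) \ {f (e (i, j i))}) := by
          rw [Set.disjoint_left]
          rintro _ ⟨a, rfl⟩ ⟨⟨b, hb⟩, hne⟩
          have h1 := e.injective (hf hb)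
          have h2 : i = a := (Prod.ext_iff.1 h1).1
          subst h2
          exact hne rfl
        have h1 := hadd (f (e (i, j i))) _ _ hd
        have h2 := hmono (f (e (i, j i))) _ (Set.range f) (Set.union_subset
          (s := Set.range fun i => f (e (i, j i)))
          (t := Set.range (fun j => f (e (i, j))) \ {f (e (i, j i))})
          (by rintro _ ⟨a, rfl⟩; exact ⟨_, rfl⟩) (by rintro _ ⟨⟨a, rfl⟩, -⟩; exact ⟨_, rfl⟩))
        have h3 := h (e (i, j i))
        have h4 := hj i
        push_cast at h3
        linarith
  obtain ⟨n, hn⟩ := exists_nat_ge (M / ε)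
  rw [div_le_iff₀ hε] at hn
  exact step n id Function.injective_id fun i => by
    simpa using (hM i).trans hn

/-- Transfinite selection of a family indexed by `K` in which each member is related to all
earlier ones, when fewer than `#K` choices never obstruct the next one. -/
theorem exists_pairwise_of_forall_lt {K : Type u} {α : Type*} [Nonempty α]
    (P : K → α → Prop) (r : α → α → Prop) (hr : ∀ a b, r a b → r b a)
    (h : ∀ (i : K) (U : Set K) (f : K → α), #U < #K → (∀ j ∈ U, P j (f j)) →
      ∃ a, P i a ∧ ∀ j ∈ U, r (f j) a) :
    ∃ f : K → α, (∀ i, P i (f i)) ∧ Pairwise fun i j => r (f i) (f j) := by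
  classical
  -- A well-order of minimal type, so that proper initial segments have fewer than `#K` elements.
  obtain ⟨s, hwo, hs⟩ := exists_ord_eq K
  have hlt : ∀ i, #{j | s j i} < #K := by
    intro i
    have h1 : Ordinal.typein s i < (#K).ord := by
      rw [hs]; exact Ordinal.typein_lt_type s i
    have h2 := (lt_ord.1 h1)
    rwa [Ordinal.card_typein] at h2
  have hwf : WellFounded s := hwo.wf
  -- The default value is never taken: the induction for `hf` shows that a valid choice always
  -- exists.
  let F : ∀ i, (∀ j, s j i → α) → α := fun i rec =>
    if h : ∃ a, P i a ∧ ∀ j (hj : s j i), r (rec j hj) a then h.choose else Classical.arbitrary α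
  let f : K → α := hwf.fix F
  have hf : ∀ i, P i (f i) ∧ ∀ j, s j i → r (f j) (f i) := by
    intro i
    induction i using hwf.induction with
    | _ i ih =>
      obtain ⟨a, ha, ha'⟩ := h i {j | s j i} f (hlt i) fun j hj => (ih j hj).1
      have hex : ∃ a, P i a ∧ ∀ j (_ : s j i), r (f j) a := ⟨a, ha, fun j hj => ha' j hj⟩
      have hfi : f i = hex.choose := by
        change hwf.fix F i = _
        rw [hwf.fix_eq]
        exact dif_pos hex
      rw [hfi]
      exact ⟨hex.choose_spec.1, fun j hj => hex.choose_spec.2 j hj⟩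
  refine ⟨f, fun i => (hf i).1, fun i j hij => ?_⟩
  rcases trichotomous_of s i j with h | h | h
  · exact (hf j).2 i h
  · exact absurd h hij
  · exact hr _ _ ((hf i).2 j h)

/-- A colouring of a large set by finite subsets of a small set `U`, refined by finitely many
colours for each of them, has a monochromatic pair. -/
theorem exists_ne_of_finset_coloring {K : Type u} [Infinite K] {U V : Set K} (hU : #U < #K)
    (hV : #V < #K) (D : K → Finset U) (n : Finset U → ℕ) (c : K → ℕ)
    (hcn : ∀ k, c k < n (D k)) :
    ∃ k ∉ V, ∃ l ∉ V, k ≠ l ∧ D k = D l ∧ c k = c l := by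
  have hS : #(Σ D : Finset U, Fin (n D)) < #K := by
    rcases finite_or_infinite U with hfin | hinf
    · have := Fintype.ofFinite U
      exact (lt_aleph0_of_finite _).trans_le (aleph0_le_mk K)
    · refine lt_of_le_of_lt ?_ hU
      calc #(Σ D : Finset U, Fin (n D)) ≤ #(Finset U × ℕ) :=
            mk_le_of_injective (f := fun x => (x.1, (x.2 : ℕ))) (by
              rintro ⟨a, x⟩ ⟨b, y⟩ hab
              obtain ⟨rfl, h⟩ := Prod.ext_iff.1 hab
              simpa [Fin.ext_iff] using h)
        _ = #U * ℵ₀ := by simp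
        _ = #U := mul_aleph0_eq (aleph0_le_mk U)
  have hc : #K ≤ #(Vᶜ : Set K) := by
    rw [mk_compl_of_infinite V hV]
  let φ : (Vᶜ : Set K) → Σ D : Finset U, Fin (n D) := fun k => ⟨D k, c k, hcn k⟩
  have : ¬ Function.Injective φ := fun hφ =>
    absurd (hc.trans (mk_le_of_injective hφ)) (not_le.2 hS)
  simp only [Function.Injective, not_forall] at this
  obtain ⟨k, l, h, hne⟩ := this
  refine ⟨k, k.2, l, l.2, fun h => hne (Subtype.ext h), ?_⟩
  have h₁ : D k = D l := congrArg Sigma.fst h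
  have h₂ := congrArg (fun x : Σ D : Finset U, Fin (n D) => (x.2 : ℕ)) h
  exact ⟨h₁, h₂⟩

end Combinatorics

/-! ### Operators induced by partial bijections of the index sets -/

section PartialPermutations

namespace PEquiv

variable {Γ Δ : Type*}

/-- The partial bijection given by an injective function. -/
noncomputable def ofInjective (f : Δ → Γ) (hf : Function.Injective f) : Δ ≃. Γ where
  toFun d := some (f d)
  invFun := Function.partialInv f
  inv d g := by
    have h := hf.isPartialInv d g
    simp only [h, Option.some.injEq]

@[simp]
theorem ofInjective_apply (f : Δ → Γ) (hf : Function.Injective f) (d : Δ) :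
    ofInjective f hf d = some (f d) := rfl

@[simp]
theorem ofInjective_symm_apply (f : Δ → Γ) (hf : Function.Injective f) (d : Δ) :
    (ofInjective f hf).symm (f d) = some d := by
  rw [PEquiv.eq_some_iff]; rfl

theorem ofInjective_symm_apply_of_notMem (f : Δ → Γ) (hf : Function.Injective f) {g : Γ}
    (hg : g ∉ Set.range f) : (ofInjective f hf).symm g = none := by
  rw [Option.eq_none_iff_forall_ne_some]
  intro d hd
  rw [PEquiv.eq_some_iff] at hd
  exact hg ⟨d, by simpa using hd⟩

/-- The identity on a set. -/
noncomputable def onSet (F : Set Γ) : Γ ≃. Γ := by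
  classical exact PEquiv.ofSet F

theorem onSet_apply_of_mem {F : Set Γ} {g : Γ} (h : g ∈ F) : onSet F g = some g := by
  classical
  exact PEquiv.ofSet_eq_some_self_iff.2 h

theorem onSet_apply_of_notMem {F : Set Γ} {g : Γ} (h : g ∉ F) : onSet F g = none := by
  classical
  rw [Option.eq_none_iff_forall_ne_some]
  intro d hd
  obtain ⟨rfl, h'⟩ := PEquiv.ofSet_eq_some_iff.1 hd
  exact h h'

end PEquiv

namespace lp

variable {𝕜 : Type*} [RCLike 𝕜] {Γ Δ : Type*} {p : ℝ≥0∞}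

theorem sum_elim_le (σ : Δ ≃. Γ) (g : Γ → ℝ) (s : Finset Δ) :
    ∃ t : Finset Γ, ∑ d ∈ s, (σ d).elim 0 g = ∑ c ∈ t, g c := by
  classical
  have hsome : ∀ d, (σ d).elim 0 g ≠ 0 → (σ d).isSome := by
    intro d hd
    by_contra h
    simp only [Option.not_isSome_iff_eq_none] at h
    simp [h] at hd
  refine ⟨s.filterMap σ fun a a' b => σ.inj, Finset.sum_bij_ne_zero
    (fun d _ hd => (σ d).get (hsome d hd)) ?_ ?_ ?_ ?_⟩
  · intro d hd h
    rw [Finset.mem_filterMap]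
    exact ⟨d, hd, by simp⟩
  · intro d _ h d' _ h' heq
    refine σ.inj (b := (σ d).get (hsome d h)) (by simp) ?_
    rw [heq]; simp
  · intro c hc hne
    obtain ⟨d, hd, hdc⟩ := (Finset.mem_filterMap _).1 hc
    exact ⟨d, hd, by simpa [hdc] using hne, by simp [hdc]⟩
  · intro d _ h
    obtain ⟨c, hc⟩ := Option.isSome_iff_exists.1 (hsome d h)
    simp [hc]

theorem norm_elim_rpow (hp : 0 < p.toReal) (x : Γ → 𝕜) (o : Option Γ) :
    ‖o.elim 0 x‖ ^ p.toReal = o.elim 0 fun c => ‖x c‖ ^ p.toReal := by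
  cases o <;> simp [Real.zero_rpow hp.ne']

theorem sum_norm_elim_le (hp : 0 < p.toReal) (σ : Δ ≃. Γ) (x : lp (fun _ : Γ => 𝕜) p)
    (s : Finset Δ) : ∑ d ∈ s, ‖(σ d).elim 0 x‖ ^ p.toReal ≤ ‖x‖ ^ p.toReal := by
  simp only [norm_elim_rpow hp]
  obtain ⟨t, ht⟩ := sum_elim_le σ (fun c => ‖x c‖ ^ p.toReal) s
  rw [ht]
  exact lp.sum_rpow_le_norm_rpow hp x t

open Classical in
variable (𝕜 p) in
/-- The unit vectors of `ℓ_p(Γ)`. -/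
noncomputable def unit (c : Γ) : lp (fun _ : Γ => 𝕜) p := lp.single p c 1

@[simp]
theorem unit_self (c : Γ) : unit 𝕜 p c c = 1 := by
  classical simp [unit]

theorem unit_of_ne {c d : Γ} (h : d ≠ c) : unit 𝕜 p c d = 0 := by
  classical simp [unit, h]

theorem sum_smul_unit_apply {K : Type*} (s : Finset K) (u : K → 𝕜) (c : K) [Decidable (c ∈ s)] :
    (∑ k ∈ s, u k • unit 𝕜 p k : lp (fun _ : K => 𝕜) p) c = if c ∈ s then u c else 0 := by
  classical
  rw [lp.coeFn_sum, Finset.sum_apply]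
  have h2 : ∀ k ∈ s, (u k • unit 𝕜 p k : lp (fun _ : K => 𝕜) p) c =
      if c = k then u k else 0 := by
    intro k _
    rw [lp.coeFn_smul, Pi.smul_apply, smul_eq_mul]
    by_cases h : c = k
    · subst h; simp
    · rw [unit_of_ne h, if_neg h, mul_zero]
  rw [Finset.sum_congr rfl h2, Finset.sum_ite_eq]
  split_ifs <;> rfl

theorem smul_unit {K : Type*} [DecidableEq K] (k : K) (a : 𝕜) :
    a • unit 𝕜 p k = lp.single p k a := by
  ext c
  rw [lp.coeFn_smul, Pi.smul_apply, smul_eq_mul, lp.single_apply]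
  by_cases h : c = k
  · subst h; simp
  · rw [unit_of_ne h]; simp [h]

variable [Fact (1 ≤ p)]

theorem zero_lt_of_fact : 0 < p := zero_lt_one.trans_le (Fact.out : 1 ≤ p)

theorem toReal_pos_of_ne_top (hp : p ≠ ∞) : 0 < p.toReal :=
  ENNReal.toReal_pos (zero_lt_of_fact (p := p)).ne' hp

theorem norm_elim_le (σ : Δ ≃. Γ) (x : lp (fun _ : Γ => 𝕜) p) (d : Δ) :
    ‖(σ d).elim 0 x‖ ≤ ‖x‖ := by
  cases σ d with
  | none => simp
  | some c => exact lp.norm_apply_le_norm (zero_lt_of_fact (p := p)).ne' x c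

theorem memℓp_elim (σ : Δ ≃. Γ) (x : lp (fun _ : Γ => 𝕜) p) :
    Memℓp (fun d => (σ d).elim 0 x) p := by
  by_cases hp : p = ∞
  · subst hp
    exact memℓp_infty ⟨‖x‖, by rintro _ ⟨d, rfl⟩; exact norm_elim_le σ x d⟩
  · exact memℓp_gen' (sum_norm_elim_le (toReal_pos_of_ne_top hp) σ x)

variable (𝕜 p) in
/-- The contraction `ℓ_p(Γ) → ℓ_p(Δ)` induced by a partial bijection. -/
noncomputable def pullback (σ : Δ ≃. Γ) : lp (fun _ : Γ => 𝕜) p →L[𝕜] lp (fun _ : Δ => 𝕜) p :=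
  LinearMap.mkContinuous
    { toFun := fun x => ⟨fun d => (σ d).elim 0 x, memℓp_elim σ x⟩
      map_add' := by
        intro x y
        ext d
        change (σ d).elim 0 _ = (σ d).elim 0 x + (σ d).elim 0 y
        cases σ d <;> simp [Option.elim]
      map_smul' := by
        intro c x
        ext d
        change (σ d).elim 0 _ = c * (σ d).elim 0 x
        cases σ d <;> simp [Option.elim] }
    1 (by
      intro x
      rw [one_mul]
      by_cases hp : p = ∞
      · subst hp
        exact lp.norm_le_of_forall_le (norm_nonneg _) fun d => norm_elim_le σ x d
      · exact lp.norm_le_of_forall_sum_le (toReal_pos_of_ne_top hp) (norm_nonneg _)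
          fun s => sum_norm_elim_le (toReal_pos_of_ne_top hp) σ x s)

theorem pullback_apply (σ : Δ ≃. Γ) (x : lp (fun _ : Γ => 𝕜) p) (d : Δ) :
    pullback 𝕜 p σ x d = (σ d).elim 0 x := rfl

theorem norm_pullback_le (σ : Δ ≃. Γ) (x : lp (fun _ : Γ => 𝕜) p) : ‖pullback 𝕜 p σ x‖ ≤ ‖x‖ := by
  refine ((pullback 𝕜 p σ).le_opNorm x).trans ?_
  exact mul_le_of_le_one_left (norm_nonneg _) (LinearMap.mkContinuous_norm_le _ zero_le_one _)

theorem pullback_ofInjective_apply (f : Δ → Γ) (hf : Function.Injective f)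
    (x : lp (fun _ : Γ => 𝕜) p) (d : Δ) : pullback 𝕜 p (.ofInjective f hf) x d = x (f d) := rfl

theorem pullback_symm_apply (f : Δ → Γ) (hf : Function.Injective f)
    (x : lp (fun _ : Δ => 𝕜) p) (d : Δ) :
    pullback 𝕜 p (PEquiv.ofInjective f hf).symm x (f d) = x d := by
  rw [pullback_apply, PEquiv.ofInjective_symm_apply]; rfl

theorem pullback_symm_apply_of_notMem (f : Δ → Γ) (hf : Function.Injective f)
    (x : lp (fun _ : Δ => 𝕜) p) {c : Γ} (hc : c ∉ Set.range f) :
    pullback 𝕜 p (PEquiv.ofInjective f hf).symm x c = 0 := by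
  rw [pullback_apply, PEquiv.ofInjective_symm_apply_of_notMem f hf hc]; rfl

theorem pullback_pullback_symm (f : Δ → Γ) (hf : Function.Injective f)
    (x : lp (fun _ : Δ => 𝕜) p) :
    pullback 𝕜 p (.ofInjective f hf) (pullback 𝕜 p (PEquiv.ofInjective f hf).symm x) = x := by
  ext d
  rw [pullback_ofInjective_apply, pullback_symm_apply]

theorem norm_pullback_symm (f : Δ → Γ) (hf : Function.Injective f)
    (x : lp (fun _ : Δ => 𝕜) p) : ‖pullback 𝕜 p (PEquiv.ofInjective f hf).symm x‖ = ‖x‖ := by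
  refine le_antisymm (norm_pullback_le _ _) ?_
  conv_lhs => rw [← pullback_pullback_symm f hf x]
  exact norm_pullback_le _ _

theorem pullback_onSet_apply_of_mem {F : Set Γ} (x : lp (fun _ : Γ => 𝕜) p) {c : Γ} (h : c ∈ F) :
    pullback 𝕜 p (.onSet F) x c = x c := by
  rw [pullback_apply, PEquiv.onSet_apply_of_mem h]; rfl

theorem pullback_onSet_apply_of_notMem {F : Set Γ} (x : lp (fun _ : Γ => 𝕜) p) {c : Γ}
    (h : c ∉ F) : pullback 𝕜 p (.onSet F) x c = 0 := by
  rw [pullback_apply, PEquiv.onSet_apply_of_notMem h]; rfl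

@[simp]
theorem norm_unit (c : Γ) : ‖unit 𝕜 p c‖ = 1 := by
  classical simp [unit, lp.norm_single (zero_lt_of_fact (p := p))]

theorem pullback_symm_unit (f : Δ → Γ) (hf : Function.Injective f) (d : Δ) :
    pullback 𝕜 p (PEquiv.ofInjective f hf).symm (unit 𝕜 p d) = unit 𝕜 p (f d) := by
  ext c
  by_cases hc : c ∈ Set.range f
  · obtain ⟨e, rfl⟩ := hc
    rw [pullback_symm_apply]
    by_cases h : e = d
    · subst h; simp
    · rw [unit_of_ne h, unit_of_ne (hf.ne h)]
  · rw [pullback_symm_apply_of_notMem f hf _ hc, unit_of_ne]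
    rintro rfl
    exact hc ⟨d, rfl⟩

end lp

end PartialPermutations

/-! ### Spaces with the supremum norm -/

section SupNorm

variable {𝕜 : Type*} [RCLike 𝕜] {K : Type*}

theorem opNorm_le_of_forall_norm_le_one {E F : Type*} [NormedAddCommGroup E] [NormedSpace 𝕜 E]
    [NormedAddCommGroup F] [NormedSpace 𝕜 F] (ψ : E →L[𝕜] F) {C : ℝ}
    (h : ∀ x, ‖x‖ ≤ 1 → ‖ψ x‖ ≤ C) : ‖ψ‖ ≤ C := by
  have hC : 0 ≤ C := (norm_nonneg _).trans (h 0 (by simp))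
  refine ψ.opNorm_le_bound hC fun x => ?_
  by_cases hx : x = 0
  · simp [hx]
  · have hx' : 0 < ‖x‖ := norm_pos_iff.2 hx
    have h1 := h (((‖x‖⁻¹ : ℝ) : 𝕜) • x) (by
      rw [norm_smul, RCLike.norm_ofReal, abs_of_pos (by positivity), inv_mul_cancel₀ hx'.ne'])
    rw [map_smul, norm_smul, RCLike.norm_ofReal, abs_of_pos (by positivity),
      inv_mul_le_iff₀ hx'] at h1
    linarith

theorem mul_norm_le_of_eq_mul_add {a z w : 𝕜} {r δ A B : ℝ} (hr : δ ≤ ‖r‖)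
    (h : z = a * (r : 𝕜) + w) (hz : ‖z‖ ≤ A) (hw : ‖w‖ ≤ B) : δ * ‖a‖ ≤ A + B := by
  have h1 : a * (r : 𝕜) = z - w := by rw [h]; ring
  calc δ * ‖a‖ ≤ ‖r‖ * ‖a‖ := by gcongr
    _ = ‖z - w‖ := by rw [← h1, norm_mul, RCLike.norm_ofReal, mul_comm, Real.norm_eq_abs]
    _ ≤ A + B := (norm_sub_le z w).trans (add_le_add hz hw)

/-- A space of bounded functions that contains the unit vectors and is stable under partial
permutations of the index set. -/
structure IsPermutable (V : Submodule 𝕜 (lp (fun _ : K => 𝕜) ∞)) : Prop where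
  pullback_mem : ∀ (σ : K ≃. K), ∀ x ∈ V, lp.pullback 𝕜 ∞ σ x ∈ V
  unit_mem : ∀ k, lp.unit 𝕜 ∞ k ∈ V

namespace IsPermutable

variable {V : Submodule 𝕜 (lp (fun _ : K => 𝕜) ∞)} (hV : IsPermutable V)

/-- The operator on the space induced by a partial permutation. -/
noncomputable def pull (σ : K ≃. K) : V →L[𝕜] V :=
  ((lp.pullback 𝕜 ∞ σ).comp V.subtypeL).codRestrict V fun x => hV.pullback_mem σ x x.2

theorem norm_pull_le (σ : K ≃. K) (x : V) : ‖hV.pull σ x‖ ≤ ‖x‖ :=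
  lp.norm_pullback_le σ (x : lp (fun _ : K => 𝕜) ∞)

/-- The unit vectors of the space. -/
noncomputable def unit (k : K) : V := ⟨lp.unit 𝕜 ∞ k, hV.unit_mem k⟩

theorem norm_unit (k : K) : ‖hV.unit k‖ = 1 := lp.norm_unit (𝕜 := 𝕜) (p := ∞) k

theorem pull_symm_unit (f : K → K) (hf : Function.Injective f) (k : K) :
    hV.pull (PEquiv.ofInjective f hf).symm (hV.unit k) = hV.unit (f k) :=
  Subtype.ext (lp.pullback_symm_unit f hf k)

include hV in
theorem nontrivial [Nonempty K] : Nontrivial V := by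
  refine ⟨⟨hV.unit (Classical.arbitrary K), 0, fun h => ?_⟩⟩
  have := hV.norm_unit (Classical.arbitrary K)
  rw [h] at this
  simp at this

theorem exists_norm_one_mul (z : 𝕜) : ∃ u : 𝕜, ‖u‖ = 1 ∧ u * z = (‖z‖ : 𝕜) := by
  by_cases hz : z = 0
  · exact ⟨1, by simp, by simp [hz]⟩
  · have hz' : (‖z‖ : 𝕜) ≠ 0 := by simpa using hz
    refine ⟨(‖z‖ : 𝕜) / z, ?_, by field_simp⟩
    rw [norm_div, RCLike.norm_ofReal, abs_norm, div_self (norm_ne_zero_iff.2 hz)]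

/-- Unimodular multiples make both values nonnegative reals, and a sum of disjointly supported
vectors in the unit ball stays in the unit ball. This is where the supremum norm enters. -/
theorem norm_add_norm_le_of_disjoint (φ : V →L[𝕜] 𝕜) {S S' : Set K} (hS : Disjoint S S') (x y : V)
    (hx : ‖x‖ ≤ 1) (hy : ‖y‖ ≤ 1) : ‖φ (hV.pull (.onSet S) x)‖ + ‖φ (hV.pull (.onSet S') y)‖ ≤
      ‖φ.comp (hV.pull (.onSet (S ∪ S')))‖ := by
  obtain ⟨a, ha, hax⟩ := exists_norm_one_mul (φ (hV.pull (.onSet S) x))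
  obtain ⟨b, hb, hby⟩ := exists_norm_one_mul (φ (hV.pull (.onSet S') y))
  set w : V := a • hV.pull (.onSet S) x + b • hV.pull (.onSet S') y with hw
  have hxc : ∀ c, ‖(x : lp (fun _ : K => 𝕜) ∞) c‖ ≤ 1 := fun c =>
    (lp.norm_apply_le_norm (by simp) _ c).trans hx
  have hyc : ∀ c, ‖(y : lp (fun _ : K => 𝕜) ∞) c‖ ≤ 1 := fun c =>
    (lp.norm_apply_le_norm (by simp) _ c).trans hy
  have hwc : ∀ c, (w : lp (fun _ : K => 𝕜) ∞) c =
      a * lp.pullback 𝕜 ∞ (.onSet S) (x : lp (fun _ : K => 𝕜) ∞) c +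
      b * lp.pullback 𝕜 ∞ (.onSet S') (y : lp (fun _ : K => 𝕜) ∞) c := fun c => rfl
  have hw1 : ‖w‖ ≤ 1 := by
    refine lp.norm_le_of_forall_le (f := (w : lp (fun _ : K => 𝕜) ∞)) zero_le_one fun c => ?_
    rw [hwc]
    by_cases h : c ∈ S
    · rw [lp.pullback_onSet_apply_of_mem _ h,
        lp.pullback_onSet_apply_of_notMem _ (Set.disjoint_left.1 hS h)]
      simpa [ha] using hxc c
    · rw [lp.pullback_onSet_apply_of_notMem _ h]
      by_cases h' : c ∈ S'
      · rw [lp.pullback_onSet_apply_of_mem _ h']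
        simpa [hb] using hyc c
      · rw [lp.pullback_onSet_apply_of_notMem _ h']
        simp
  have hwS : hV.pull (.onSet (S ∪ S')) w = w := by
    ext c
    change lp.pullback 𝕜 ∞ (.onSet (S ∪ S')) (w : lp (fun _ : K => 𝕜) ∞) c = _
    by_cases h : c ∈ S ∪ S'
    · rw [lp.pullback_onSet_apply_of_mem _ h]
    · rw [lp.pullback_onSet_apply_of_notMem _ h, hwc,
        lp.pullback_onSet_apply_of_notMem _ (fun h' => h (Or.inl h')),
        lp.pullback_onSet_apply_of_notMem _ (fun h' => h (Or.inr h'))]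
      simp
  have h1 : φ w = ((‖φ (hV.pull (.onSet S) x)‖ + ‖φ (hV.pull (.onSet S') y)‖ : ℝ) : 𝕜) := by
    rw [hw, map_add, map_smul, map_smul, smul_eq_mul, smul_eq_mul, hax, hby]
    push_cast; rfl
  have h2 := (φ.comp (hV.pull (.onSet (S ∪ S')))).le_opNorm w
  rw [ContinuousLinearMap.comp_apply, hwS, h1, RCLike.norm_ofReal,
    abs_of_nonneg (by positivity)] at h2
  exact h2.trans (mul_le_of_le_one_right (ContinuousLinearMap.opNorm_nonneg _) hw1)

theorem norm_comp_add_norm_comp_le (φ : V →L[𝕜] 𝕜) {S S' : Set K} (hS : Disjoint S S') :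
    ‖φ.comp (hV.pull (.onSet S))‖ + ‖φ.comp (hV.pull (.onSet S'))‖ ≤
      ‖φ.comp (hV.pull (.onSet (S ∪ S')))‖ := by
  rw [← le_sub_iff_add_le]
  refine opNorm_le_of_forall_norm_le_one _ fun x hx => ?_
  rw [le_sub_iff_add_le, ← le_sub_iff_add_le']
  refine opNorm_le_of_forall_norm_le_one _ fun y hy => ?_
  rw [le_sub_iff_add_le']
  exact hV.norm_add_norm_le_of_disjoint φ hS x y hx hy

theorem pull_symm_eq_smul_unit_add (g : K → K) (hg : Function.Injective g) (x : V) (i : K) :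
    hV.pull (PEquiv.ofInjective g hg).symm x =
      (x : lp (fun _ : K => 𝕜) ∞) i • hV.unit (g i) + hV.pull (.onSet (Set.range g \ {g i}))
        (hV.pull (PEquiv.ofInjective g hg).symm x) := by
  refine Subtype.ext (lp.ext (funext fun c => ?_))
  change lp.pullback 𝕜 ∞ (PEquiv.ofInjective g hg).symm (x : lp (fun _ : K => 𝕜) ∞) c =
    (x : lp (fun _ : K => 𝕜) ∞) i * lp.unit 𝕜 ∞ (g i) c +
      lp.pullback 𝕜 ∞ (.onSet (Set.range g \ {g i}))
        (lp.pullback 𝕜 ∞ (PEquiv.ofInjective g hg).symm (x : lp (fun _ : K => 𝕜) ∞)) c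
  generalize (x : lp (fun _ : K => 𝕜) ∞) = z
  by_cases hc : c = g i
  · subst hc
    rw [lp.pullback_onSet_apply_of_notMem _ (by simp), lp.pullback_symm_apply, lp.unit_self,
      mul_one, add_zero]
  · rw [lp.unit_of_ne hc, mul_zero, zero_add]
    by_cases hr : c ∈ Set.range g
    · rw [lp.pullback_onSet_apply_of_mem _ (show c ∈ Set.range g \ {g i} from ⟨hr, hc⟩)]
    · rw [lp.pullback_onSet_apply_of_notMem _ (fun h => hr h.1),
        lp.pullback_symm_apply_of_notMem g hg z hr]

variable {Y : Type*} [NormedAddCommGroup Y] [NormedSpace 𝕜 Y]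

theorem norm_comp_pull_le (φ : V →L[𝕜] 𝕜) (σ : K ≃. K) : ‖φ.comp (hV.pull σ)‖ ≤ ‖φ‖ :=
  ContinuousLinearMap.opNorm_le_bound _ (ContinuousLinearMap.opNorm_nonneg _) fun x =>
    (φ.le_opNorm _).trans
      (mul_le_mul_of_nonneg_left (hV.norm_pull_le σ x) (ContinuousLinearMap.opNorm_nonneg _))

/-- Rosenthal's lemma applied to the set functions `S ↦ ‖φ k ∘ P_S‖`, where `P_S` restricts to `S`:
they are superadditive and bounded by `M`. -/
theorem exists_injective_forall_norm_le [Infinite K] (φ : K → V →L[𝕜] 𝕜) {M : ℝ}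
    (hφ : ∀ k, ‖φ k‖ ≤ M) {ε : ℝ} (hε : 0 < ε) :
    ∃ g : K → K, Function.Injective g ∧
      ∀ i z, ‖φ (g i) (hV.pull (.onSet (Set.range g \ {g i})) z)‖ ≤ ε * ‖z‖ := by
  obtain ⟨g, hg, hgv⟩ := exists_injective_superadditive_le
    (fun k S => ‖(φ k).comp (hV.pull (.onSet S))‖)
    (fun _ _ => ContinuousLinearMap.opNorm_nonneg _)
    (fun k S S' h => hV.norm_comp_add_norm_comp_le _ h) (M := M)
    (fun k => (hV.norm_comp_pull_le _ _).trans (hφ k)) hε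
  exact ⟨g, hg, fun i z => ContinuousLinearMap.le_of_opNorm_le _ (hgv i) z⟩

/-- Rosenthal's theorem: an operator that is bounded away from zero on the unit vectors is bounded
below on the span of a family of unit vectors of full cardinality. -/
theorem exists_injective_le_norm [Infinite K] (T : V →L[𝕜] Y) {δ : ℝ} (hδ : 0 < δ)
    (hT : ∀ k, δ ≤ ‖T (hV.unit k)‖) :
    ∃ (g : K → K) (hg : Function.Injective g),
      ∀ x, δ / 2 * ‖x‖ ≤ ‖T (hV.pull (PEquiv.ofInjective g hg).symm x)‖ := by
  -- Norming functionals for the images: the diagonal term is at least `δ`, and thinning out makes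
  -- the off-diagonal part at most `δ / 2`.
  choose φ hφ hφT using fun k => exists_dual_vector'' 𝕜 (T (hV.unit k))
  obtain ⟨g, hg, hoff⟩ := hV.exists_injective_forall_norm_le (fun k => (φ k).comp T) (M := ‖T‖)
    (fun k => (ContinuousLinearMap.opNorm_comp_le _ _).trans
      (mul_le_of_le_one_left (ContinuousLinearMap.opNorm_nonneg _) (hφ k))) (half_pos hδ)
  refine ⟨g, hg, fun x => ?_⟩
  have hdec := hV.pull_symm_eq_smul_unit_add g hg x
  have hyx : ‖hV.pull (PEquiv.ofInjective g hg).symm x‖ ≤ ‖x‖ := hV.norm_pull_le _ _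
  generalize hV.pull (PEquiv.ofInjective g hg).symm x = y at hdec hyx ⊢
  have hcoord : ∀ i, δ * ‖(x : lp (fun _ : K => 𝕜) ∞) i‖ ≤ ‖T y‖ + δ / 2 * ‖x‖ := by
    intro i
    have h0 := hoff i y
    have hd := hdec i
    generalize hV.pull (.onSet (Set.range g \ {g i})) y = w at h0 hd
    generalize (x : lp (fun _ : K => 𝕜) ∞) i = a at hd ⊢
    refine mul_norm_le_of_eq_mul_add ((hT (g i)).trans (Real.le_norm_self _))
      (z := φ (g i) (T y)) (w := φ (g i) (T w)) ?_
      (((φ (g i)).le_opNorm _).trans (mul_le_of_le_one_left (norm_nonneg _) (hφ _)))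
      (h0.trans (mul_le_mul_of_nonneg_left hyx (half_pos hδ).le))
    rw [← hφT (g i), hd, T.map_add, T.map_smul, (φ (g i)).map_add, (φ (g i)).map_smul, smul_eq_mul]
  have hnorm : ‖x‖ ≤ (‖T y‖ + δ / 2 * ‖x‖) / δ := by
    refine lp.norm_le_of_forall_le (f := (x : lp (fun _ : K => 𝕜) ∞)) (by positivity) fun i => ?_
    rw [le_div_iff₀ hδ, mul_comm]
    exact hcoord i
  rw [le_div_iff₀ hδ] at hnorm
  linarith

theorem boundedBelowOnCopy_of_unit [Infinite K] {X : Type*} [NormedAddCommGroup X]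
    [NormedSpace 𝕜 X] (J : V →L[𝕜] X) (T : X →L[𝕜] Y) {δ : ℝ} (hδ : 0 < δ)
    (hT : ∀ k, δ ≤ ‖T (J (hV.unit k))‖) : BoundedBelowOnCopy (𝕜 := 𝕜) V T := by
  obtain ⟨g, hg, h⟩ := hV.exists_injective_le_norm (T.comp J) hδ hT
  exact boundedBelowOnCopy_of_comp (J.comp (hV.pull (PEquiv.ofInjective g hg).symm)) T
    (half_pos hδ) h

include hV in
-- Additivity need only be tested on unit vectors, by Rosenthal's theorem.
theorem isClosedIdeal_singularOps [Infinite K] : IsClosedIdeal (singularOps 𝕜 V Y) := by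
  have := hV.nontrivial
  refine _root_.isClosedIdeal_singularOps fun A B c hc h => ?_
  obtain ⟨g, hg, hAB⟩ := exists_injective_forall_or
    (P := fun k => c / 2 ≤ ‖A (hV.unit k)‖) (Q := fun k => c / 2 ≤ ‖B (hV.unit k)‖) (by
      intro k
      by_contra! hk
      have h1 := h (hV.unit k)
      rw [hV.norm_unit] at h1
      linarith [norm_add_le (A (hV.unit k)) (B (hV.unit k)), hk.1, hk.2])
  refine hAB.imp (fun h => ?_) fun h => ?_
  all_goals
    refine hV.boundedBelowOnCopy_of_unit (hV.pull (PEquiv.ofInjective g hg).symm) _ (half_pos hc) ?_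
    intro k
    rw [hV.pull_symm_unit]
    exact h k

end IsPermutable

theorem isPermutable_top : IsPermutable (⊤ : Submodule 𝕜 (lp (fun _ : K => 𝕜) ∞)) :=
  ⟨fun _ _ _ => trivial, fun _ => trivial⟩

theorem isPermutable_linftyc : IsPermutable (linftyc 𝕜 K) where
  pullback_mem σ x hx := by
    change {d | (σ d).elim 0 x ≠ 0}.Countable
    refine ((Set.Countable.image hx σ.symm).preimage_of_injOn (f := some)
      (Option.some_injective _).injOn).mono ?_
    intro d hd
    cases h : σ d with
    | none => simp [h] at hd
    | some c =>
      refine ⟨c, by simpa [h] using hd, ?_⟩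
      rw [PEquiv.eq_some_iff]; exact h
  unit_mem k := by
    refine (Set.countable_singleton k).mono fun d hd => ?_
    by_contra h
    exact hd (lp.unit_of_ne h)

theorem isPermutable_c0Space : IsPermutable (c0Space 𝕜 K) where
  pullback_mem σ x hx := by
    change Tendsto (fun d => (σ d).elim 0 x) cofinite (𝓝 0)
    rw [tendsto_zero_iff_norm_tendsto_zero, Metric.tendsto_nhds]
    intro ε hε
    have hx' := (Metric.tendsto_nhds.1 (show Tendsto (fun γ => x γ) cofinite (𝓝 0) from hx)) ε hε
    rw [eventually_cofinite] at hx' ⊢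
    refine ((Set.Finite.image σ.symm hx').preimage (f := some)
      (Option.some_injective _).injOn).subset ?_
    intro d hd
    cases h : σ d with
    | none =>
      simp only [Set.mem_ofPred_eq, h, Option.elim, norm_zero, dist_self] at hd
      exact absurd hε hd
    | some c =>
      refine ⟨c, by simpa [h] using hd, ?_⟩
      rw [PEquiv.eq_some_iff]; exact h
  unit_mem k := by
    change Tendsto (fun d => lp.unit 𝕜 ∞ k d) cofinite (𝓝 0)
    refine tendsto_const_nhds.congr' ?_
    filter_upwards [(Set.finite_singleton k).compl_mem_cofinite] with d hd
    exact (lp.unit_of_ne hd).symm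

theorem c0Space_le_linftyc : c0Space 𝕜 K ≤ linftyc 𝕜 K := by
  intro x hx
  have hx' : Tendsto (fun γ => x γ) cofinite (𝓝 0) := hx
  have := hx'.countable_compl_preimage_ker
  rw [ker_nhds] at this
  exact this

end SupNorm

/-! ### Extending operators from `c₀` to bounded functions of countable support -/

section Extension

variable {𝕜 : Type*} [RCLike 𝕜] {K L : Type*}

theorem isClosedIdeal_singularOps_lp_top [Infinite K] {Y : Type*} [NormedAddCommGroup Y]
    [NormedSpace 𝕜 Y] : IsClosedIdeal (singularOps 𝕜 (lp (fun _ : K => 𝕜) ∞) Y) := by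
  let e : (⊤ : Submodule 𝕜 (lp (fun _ : K => 𝕜) ∞)) ≃L[𝕜] lp (fun _ : K => 𝕜) ∞ :=
    (LinearIsometryEquiv.ofTop _ _ rfl).toContinuousLinearEquiv
  have h : singularOps 𝕜 (lp (fun _ : K => 𝕜) ∞) Y =
      singularOps 𝕜 (⊤ : Submodule 𝕜 (lp (fun _ : K => 𝕜) ∞)) Y := by
    ext T
    refine not_congr ⟨?_, ?_⟩
    · rintro ⟨E₀, ⟨f⟩, hE⟩
      exact ⟨E₀, ⟨f.trans e.symm⟩, hE⟩
    · rintro ⟨E₀, ⟨f⟩, hE⟩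
      exact ⟨E₀, ⟨f.trans e⟩, hE⟩
  rw [h]
  exact isPermutable_top.isClosedIdeal_singularOps

theorem map_sum_smul_clm {E F : Type*} [NormedAddCommGroup E] [NormedSpace 𝕜 E]
    [NormedAddCommGroup F] [NormedSpace 𝕜 F] (T : E →L[𝕜] F) (s : Finset K) (u : K → 𝕜) (e : K → E) :
    T (∑ k ∈ s, u k • e k) = ∑ k ∈ s, u k • T (e k) := by
  simp only [map_sum, map_smul]

/-- Test `U` on a combination of unit vectors whose unimodular coefficients align all the terms of
row `α`; it lies in the unit ball of `c₀`. -/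
theorem sum_norm_apply_unit_le (U : c0Space 𝕜 K →L[𝕜] linftyc 𝕜 L) (α : L) (s : Finset K) :
    ∑ k ∈ s, ‖(U (isPermutable_c0Space.unit k) : lp (fun _ : L => 𝕜) ∞) α‖ ≤ ‖U‖ := by
  classical
  choose u hu hu' using fun k => IsPermutable.exists_norm_one_mul
    ((U (isPermutable_c0Space.unit k) : lp (fun _ : L => 𝕜) ∞) α)
  set y : c0Space 𝕜 K := ∑ k ∈ s, u k • isPermutable_c0Space.unit k with hy
  have hyc : ∀ c, (y : lp (fun _ : K => 𝕜) ∞) c = if c ∈ s then u c else 0 := by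
    intro c
    have h1 : (y : lp (fun _ : K => 𝕜) ∞) = ∑ k ∈ s, u k • lp.unit 𝕜 ∞ k := by
      rw [hy, Submodule.coe_sum]; rfl
    rw [h1, lp.sum_smul_unit_apply s u]
  have hy1 : ‖y‖ ≤ 1 := by
    refine lp.norm_le_of_forall_le (f := (y : lp (fun _ : K => 𝕜) ∞)) zero_le_one fun c => ?_
    rw [hyc]
    split_ifs
    · exact (hu c).le
    · simp
  have hUy : (U y : lp (fun _ : L => 𝕜) ∞) α =
      ((∑ k ∈ s, ‖(U (isPermutable_c0Space.unit k) : lp (fun _ : L => 𝕜) ∞) α‖ : ℝ) : 𝕜) := by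
    rw [hy, map_sum_smul_clm, Submodule.coe_sum, lp.coeFn_sum, Finset.sum_apply,
      RCLike.ofReal_sum]
    exact Finset.sum_congr rfl fun k _ => hu' k
  have h3 : ‖(U y : lp (fun _ : L => 𝕜) ∞) α‖ ≤ ‖U‖ :=
    (lp.norm_apply_le_norm (by simp) _ α).trans
      ((U.le_opNorm y).trans (mul_le_of_le_one_right (ContinuousLinearMap.opNorm_nonneg _) hy1))
  rwa [hUy, RCLike.norm_ofReal, abs_of_nonneg (Finset.sum_nonneg fun _ _ => norm_nonneg _)] at h3

/-- Bounded functions act on matrices with uniformly absolutely summable rows and countably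
supported columns. -/
theorem exists_linftyc_extension (a : L → K → 𝕜) {M : ℝ}
    (ha : ∀ α (s : Finset K), ∑ k ∈ s, ‖a α k‖ ≤ M) (hc : ∀ k, {α | a α k ≠ 0}.Countable) :
    ∃ W : linftyc 𝕜 K →L[𝕜] linftyc 𝕜 L, ∀ k α,
      (W (isPermutable_linftyc.unit k) : lp (fun _ : L => 𝕜) ∞) α = a α k := by
  have hM : ∀ α, Summable fun k => ‖a α k‖ := fun α =>
    summable_of_sum_le (fun _ => norm_nonneg _) (ha α)
  have hle : ∀ (x : lp (fun _ : K => 𝕜) ∞) α k, ‖x k * a α k‖ ≤ ‖x‖ * ‖a α k‖ := by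
    intro x α k
    rw [norm_mul]
    gcongr
    exact lp.norm_apply_le_norm (by simp) x k
  have hsn : ∀ (x : lp (fun _ : K => 𝕜) ∞) α, Summable fun k => ‖x k * a α k‖ := fun x α =>
    Summable.of_nonneg_of_le (fun _ => norm_nonneg _) (hle x α) ((hM α).mul_left _)
  have hs : ∀ (x : lp (fun _ : K => 𝕜) ∞) α, Summable fun k => x k * a α k := fun x α =>
    (hsn x α).of_norm
  have hb : ∀ (x : lp (fun _ : K => 𝕜) ∞) α, ‖∑' k, x k * a α k‖ ≤ M * ‖x‖ := by
    intro x α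
    calc ‖∑' k, x k * a α k‖ ≤ ∑' k, ‖x k * a α k‖ := norm_tsum_le_tsum_norm (hsn x α)
      _ ≤ ∑' k, ‖x‖ * ‖a α k‖ := (hsn x α).tsum_le_tsum (hle x α) ((hM α).mul_left _)
      _ = ‖x‖ * ∑' k, ‖a α k‖ := tsum_mul_left
      _ ≤ ‖x‖ * M := by
        gcongr
        exact (hM α).tsum_le_of_sum_le (ha α)
      _ = _ := mul_comm _ _
  let w : lp (fun _ : K => 𝕜) ∞ →ₗ[𝕜] lp (fun _ : L => 𝕜) ∞ :=
    { toFun := fun x => ⟨fun α => ∑' k, x k * a α k,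
        memℓp_infty ⟨M * ‖x‖, by rintro _ ⟨α, rfl⟩; exact hb x α⟩⟩
      map_add' := by
        intro x y
        ext α
        change ∑' k, (x + y) k * a α k = ∑' k, x k * a α k + ∑' k, y k * a α k
        rw [← (hs x α).tsum_add (hs y α)]
        refine tsum_congr fun k => ?_
        rw [lp.coeFn_add, Pi.add_apply, add_mul]
      map_smul' := by
        intro c x
        ext α
        change ∑' k, (c • x) k * a α k = c * ∑' k, x k * a α k
        rw [← tsum_mul_left]
        refine tsum_congr fun k => ?_
        rw [lp.coeFn_smul, Pi.smul_apply, smul_eq_mul, mul_assoc] }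
  -- The support of the image lies in a union of countable column supports over the countable
  -- support of `x`.
  have hw : ∀ x : linftyc 𝕜 K, w x ∈ linftyc 𝕜 L := by
    intro x
    refine (Set.Countable.biUnion (show {k | (x : lp (fun _ : K => 𝕜) ∞) k ≠ 0}.Countable from x.2)
      fun k _ => hc k).mono fun α hα => ?_
    by_contra h
    refine hα ?_
    change ∑' k, (x : lp (fun _ : K => 𝕜) ∞) k * a α k = 0
    simp only [Set.mem_iUnion, not_exists] at h
    have h0 : ∀ k, (x : lp (fun _ : K => 𝕜) ∞) k * a α k = 0 := by
      intro k
      by_cases hk : (x : lp (fun _ : K => 𝕜) ∞) k = 0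
      · rw [hk, zero_mul]
      · rw [not_not.1 (h k hk), mul_zero]
    simp only [h0, tsum_zero]
  refine ⟨LinearMap.mkContinuous ((w.comp (linftyc 𝕜 K).subtype).codRestrict (linftyc 𝕜 L) hw)
    (|M|) fun x => ?_, fun k α => ?_⟩
  · refine lp.norm_le_of_forall_le (f := w x) (by positivity) fun α => ?_
    exact (hb x α).trans (mul_le_mul_of_nonneg_right (le_abs_self M) (norm_nonneg _))
  · change ∑' j, lp.unit 𝕜 ∞ k j * a α j = _
    rw [tsum_eq_single k, lp.unit_self, one_mul]
    intro j hj
    rw [lp.unit_of_ne hj, zero_mul]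

/-- One direction restricts to `c₀`. Conversely, extend the matrix of the embedding of `c₀` to
bounded functions; the extension need not be an embedding, but it keeps the lower bound on unit
vectors, and Rosenthal's theorem does the rest. -/
theorem boundedBelowOnCopy_linftyc_iff [Infinite K] {Y : Type*} [NormedAddCommGroup Y]
    [NormedSpace 𝕜 Y] (T : linftyc 𝕜 L →L[𝕜] Y) :
    BoundedBelowOnCopy (𝕜 := 𝕜) (linftyc 𝕜 K) T ↔ BoundedBelowOnCopy (𝕜 := 𝕜) (c0Space 𝕜 K) T := by
  constructor
  · intro h
    let i : c0Space 𝕜 K →L[𝕜] linftyc 𝕜 K :=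
      (c0Space 𝕜 K).subtypeL.codRestrict (linftyc 𝕜 K) fun x => c0Space_le_linftyc x.2
    exact boundedBelowOnCopy_comp_of_exists h i one_pos fun x => (one_mul ‖x‖).le
  · intro h
    obtain ⟨U, c, hc, h⟩ := h.exists_comp
    obtain ⟨W, hW⟩ := exists_linftyc_extension (K := K)
      (fun α k => (U (isPermutable_c0Space.unit k) : lp (fun _ : L => 𝕜) ∞) α)
      (sum_norm_apply_unit_le U) fun k => (U (isPermutable_c0Space.unit k)).2
    refine isPermutable_linftyc.boundedBelowOnCopy_of_unit W T hc fun k => ?_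
    have h1 : W (isPermutable_linftyc.unit k) = U (isPermutable_c0Space.unit k) :=
      Subtype.ext (lp.ext (funext (hW k)))
    have h2 := h (isPermutable_c0Space.unit k)
    rwa [IsPermutable.norm_unit, mul_one, ← h1] at h2

end Extension

/-! ### Disjointly supported sequences in `ℓ_p` -/

section LpHumps

namespace lp

variable {𝕜 : Type*} [RCLike 𝕜] {p : ℝ≥0∞} [Fact (1 ≤ p)]

theorem countable_support {M : Type*} (hp : p ≠ ∞) (x : lp (fun _ : M => 𝕜) p) :
    {c | x c ≠ 0}.Countable := by
  refine ((lp.memℓp x).summable (toReal_pos_of_ne_top hp)).countable_support.mono fun c hc => ?_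
  exact (Real.rpow_pos_of_pos (norm_pos_iff.2 hc) _).ne'

theorem norm_rpow_sum_smul_unit {K : Type*} (hp : p ≠ ∞) (s : Finset K) (u : K → 𝕜) :
    ‖∑ k ∈ s, u k • unit 𝕜 p k‖ ^ p.toReal = ∑ k ∈ s, ‖u k‖ ^ p.toReal := by
  classical
  simp only [smul_unit]
  exact lp.norm_sum_single (toReal_pos_of_ne_top hp) u s

theorem hasSum_smul_unit {K : Type*} (hp : p ≠ ∞) (x : lp (fun _ : K => 𝕜) p) :
    HasSum (fun k => x k • unit 𝕜 p k) x := by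
  classical
  simp only [smul_unit]
  exact lp.hasSum_single hp x

theorem pullback_onSet_congr {M : Type*} (F : Set M) (x y : lp (fun _ : M => 𝕜) p)
    (h : ∀ c ∈ F, x c = y c) : pullback 𝕜 p (.onSet F) x = pullback 𝕜 p (.onSet F) y := by
  ext c
  by_cases hc : c ∈ F
  · rw [pullback_onSet_apply_of_mem _ hc, pullback_onSet_apply_of_mem _ hc, h c hc]
  · rw [pullback_onSet_apply_of_notMem _ hc, pullback_onSet_apply_of_notMem _ hc]

theorem pullback_onSet_union {M : Type*} {F G : Set M} (h : Disjoint F G)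
    (x : lp (fun _ : M => 𝕜) p) : pullback 𝕜 p (.onSet (F ∪ G)) x =
      pullback 𝕜 p (.onSet F) x + pullback 𝕜 p (.onSet G) x := by
  ext c
  rw [lp.coeFn_add, Pi.add_apply]
  by_cases hF : c ∈ F
  · rw [pullback_onSet_apply_of_mem _ (Set.mem_union_left G hF), pullback_onSet_apply_of_mem _ hF,
      pullback_onSet_apply_of_notMem _ (Set.disjoint_left.1 h hF), add_zero]
  · rw [pullback_onSet_apply_of_notMem _ hF, zero_add]
    by_cases hG : c ∈ G
    · rw [pullback_onSet_apply_of_mem _ (Set.mem_union_right F hG), pullback_onSet_apply_of_mem _ hG]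
    · rw [pullback_onSet_apply_of_notMem _ hG,
        pullback_onSet_apply_of_notMem _ (fun h => h.elim hF hG)]

theorem pullback_onSet_univ {M : Type*} (x : lp (fun _ : M => 𝕜) p) :
    pullback 𝕜 p (.onSet Set.univ) x = x := by
  ext c
  rw [pullback_onSet_apply_of_mem _ (Set.mem_univ c)]

theorem pullback_onSet_pullback_onSet {M : Type*} {F G : Set M} (h : F ⊆ G)
    (x : lp (fun _ : M => 𝕜) p) :
    pullback 𝕜 p (.onSet F) (pullback 𝕜 p (.onSet G) x) = pullback 𝕜 p (.onSet F) x :=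
  pullback_onSet_congr _ _ _ fun _ hc => pullback_onSet_apply_of_mem _ (h hc)

theorem norm_pullback_onSet_mono {M : Type*} {F G : Set M} (h : F ⊆ G)
    (x : lp (fun _ : M => 𝕜) p) :
    ‖pullback 𝕜 p (.onSet F) x‖ ≤ ‖pullback 𝕜 p (.onSet G) x‖ := by
  rw [← pullback_onSet_pullback_onSet h]
  exact norm_pullback_le _ _

theorem norm_pullback_onSet_le_sum {M : Type*} (H : Finset M) (x : lp (fun _ : M => 𝕜) p) :
    ‖pullback 𝕜 p (.onSet (H : Set M)) x‖ ≤ ∑ c ∈ H, ‖x c‖ := by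
  classical
  have h : pullback 𝕜 p (.onSet (H : Set M)) x = ∑ c ∈ H, x c • unit 𝕜 p c := by
    ext c
    rw [sum_smul_unit_apply H (fun c => x c)]
    split_ifs with hc
    · exact pullback_onSet_apply_of_mem _ hc
    · exact pullback_onSet_apply_of_notMem _ hc
  rw [h]
  refine (norm_sum_le _ _).trans (Finset.sum_le_sum fun c _ => ?_)
  rw [norm_smul, norm_unit, mul_one]

theorem exists_finset_norm_pullback_le {M : Type*} (hp : p ≠ ∞) (x : lp (fun _ : M => 𝕜) p)
    (G : Set M) {η : ℝ} (hη : 0 < η) :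
    ∃ H : Finset M, (H : Set M) ⊆ G ∧ ‖pullback 𝕜 p (.onSet (G \ H)) x‖ ≤ η := by
  classical
  obtain ⟨s, hs⟩ := (((hasSum_smul_unit hp x).eventually (Metric.ball_mem_nhds x hη))).exists
  refine ⟨s.filter (· ∈ G), fun c hc => (Finset.mem_filter.1 hc).2, ?_⟩
  rw [dist_eq_norm, norm_sub_rev] at hs
  refine le_trans ?_ hs.le
  rw [pullback_onSet_congr _ x (x - ∑ k ∈ s, x k • unit 𝕜 p k)]
  · exact norm_pullback_le _ _
  · intro c hc
    rw [lp.coeFn_sub, Pi.sub_apply, sum_smul_unit_apply s (fun k => x k), if_neg, sub_zero]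
    intro hcs
    exact hc.2 (Finset.mem_coe.2 (Finset.mem_filter.2 ⟨hcs, hc.1⟩))

theorem sum_norm_rpow_pullback_onSet_le {K M : Type*} (hp : p ≠ ∞) (F : K → Set M)
    (hF : Pairwise fun i j => Disjoint (F i) (F j)) (s : Finset K) (w : lp (fun _ : M => 𝕜) p) :
    ∑ i ∈ s, ‖pullback 𝕜 p (.onSet (F i)) w‖ ^ p.toReal ≤ ‖w‖ ^ p.toReal := by
  classical
  have hp0 := toReal_pos_of_ne_top hp
  refine hasSum_le (fun c => ?_) (hasSum_sum fun i _ => lp.hasSum_norm hp0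
    (pullback 𝕜 p (.onSet (F i)) w)) (lp.hasSum_norm hp0 w)
  by_cases h : ∃ i ∈ s, c ∈ F i
  · obtain ⟨i, hi, hc⟩ := h
    rw [Finset.sum_eq_single_of_mem i hi]
    · rw [pullback_onSet_apply_of_mem _ hc]
    · intro j _ hj
      rw [pullback_onSet_apply_of_notMem _ (Set.disjoint_left.1 (hF hj.symm) hc)]
      simp [Real.zero_rpow hp0.ne']
  · push Not at h
    rw [Finset.sum_eq_zero]
    · positivity
    · intro i hi
      rw [pullback_onSet_apply_of_notMem _ (h i hi)]
      simp [Real.zero_rpow hp0.ne']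

/-- An operator that sends the unit vectors to small perturbations of disjointly supported vectors
is bounded below. -/
theorem mul_norm_le_of_disjoint {K M : Type*} (hp : p ≠ ∞)
    (T : lp (fun _ : K => 𝕜) p →L[𝕜] lp (fun _ : M => 𝕜) p) (F : K → Set M)
    (hF : Pairwise fun i j => Disjoint (F i) (F j)) (E : K → ℝ) {ε δ : ℝ} (hεδ : ε ≤ δ)
    (hE : ∀ (x : lp (fun _ : K => 𝕜) p) (s : Finset K), ∑ i ∈ s, ‖x i‖ * E i ≤ ε * ‖x‖)
    (hT : ∀ i, δ ≤ ‖T (unit 𝕜 p i)‖)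
    (hTF : ∀ i, ‖T (unit 𝕜 p i) - pullback 𝕜 p (.onSet (F i)) (T (unit 𝕜 p i))‖ ≤ E i)
    (x : lp (fun _ : K => 𝕜) p) : (δ - 2 * ε) * ‖x‖ ≤ ‖T x‖ := by
  classical
  have hp0 := toReal_pos_of_ne_top hp
  set u : K → lp (fun _ : M => 𝕜) p := fun i => pullback 𝕜 p (.onSet (F i)) (T (unit 𝕜 p i)) with hu
  have hEε : ∀ i, E i ≤ ε := fun i => by simpa using hE (unit 𝕜 p i) {i}
  have hui : ∀ i, δ - ε ≤ ‖u i‖ := by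
    intro i
    have h1 := norm_sub_norm_le (T (unit 𝕜 p i)) (u i)
    linarith [hT i, hTF i, hEε i]
  -- Projecting onto the disjoint sets `F i` gives the factor `δ - ε`; replacing `u i` by the true
  -- images costs another `ε`. Infinite sums follow by passing to the limit.
  have hfin : ∀ s : Finset K,
      (δ - ε) * ‖∑ k ∈ s, x k • unit 𝕜 p k‖ ≤ ‖T (∑ k ∈ s, x k • unit 𝕜 p k)‖ + ε * ‖x‖ := by
    intro s
    set w := ∑ k ∈ s, x k • u k with hw
    have hPw : ∀ i ∈ s, pullback 𝕜 p (.onSet (F i)) w = x i • u i := by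
      intro i hi
      rw [hw, map_sum_smul_clm, Finset.sum_eq_single_of_mem i hi]
      · rw [hu, pullback_onSet_pullback_onSet subset_rfl]
      · intro j _ hj
        have : pullback 𝕜 p (.onSet (F i)) (u j) = 0 := by
          rw [← map_zero (pullback 𝕜 p (.onSet (F i)) : lp (fun _ : M => 𝕜) p →L[𝕜] _)]
          exact pullback_onSet_congr _ _ _ fun c hc =>
            pullback_onSet_apply_of_notMem _ (Set.disjoint_left.1 (hF hj.symm) hc)
        rw [this, smul_zero]
    have h1 : (δ - ε) * ‖∑ k ∈ s, x k • unit 𝕜 p k‖ ≤ ‖w‖ := by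
      rw [← Real.rpow_le_rpow_iff (mul_nonneg (sub_nonneg.2 hεδ) (norm_nonneg _)) (norm_nonneg _)
        hp0, Real.mul_rpow (sub_nonneg.2 hεδ) (norm_nonneg _), norm_rpow_sum_smul_unit hp,
        Finset.mul_sum]
      refine le_trans (Finset.sum_le_sum fun i hi => ?_) (sum_norm_rpow_pullback_onSet_le hp F hF s w)
      rw [hPw i hi, norm_smul, Real.mul_rpow (norm_nonneg _) (norm_nonneg _), mul_comm]
      refine mul_le_mul_of_nonneg_left (Real.rpow_le_rpow ?_ ?_ hp0.le) (by positivity)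
      · exact sub_nonneg.2 hεδ
      · exact hui i
    have h2 : ‖w - T (∑ k ∈ s, x k • unit 𝕜 p k)‖ ≤ ε * ‖x‖ := by
      rw [map_sum_smul_clm, hw, ← Finset.sum_sub_distrib]
      refine (norm_sum_le _ _).trans (le_trans (Finset.sum_le_sum fun i _ => ?_) (hE x s))
      rw [← smul_sub, norm_smul, norm_sub_rev]
      gcongr
      exact hTF i
    linarith [norm_sub_norm_le w (T (∑ k ∈ s, x k • unit 𝕜 p k))]
  have hlim := hasSum_smul_unit hp x
  have h3 : (δ - ε) * ‖x‖ ≤ ‖T x‖ + ε * ‖x‖ :=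
    le_of_tendsto_of_tendsto (hlim.norm.const_mul _)
      (((T.continuous.tendsto x).comp hlim).norm.add_const _) (Eventually.of_forall hfin)
  linarith

/-- If `n` unit vectors have values at least `ε` in modulus, their aligned sum has norm `n ^ (1 /
p)` and value at least `n * ε`, which bounds `n` because `p > 1`. -/
theorem countable_apply_unit_ne_zero {K : Type*} (hp : p ≠ ∞) (hp1 : 1 < p)
    (φ : lp (fun _ : K => 𝕜) p →L[𝕜] 𝕜) : {k | φ (unit 𝕜 p k) ≠ 0}.Countable := by
  have hp0 := toReal_pos_of_ne_top hp
  have hp1' : 1 < p.toReal := by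
    rw [← ENNReal.toReal_one]
    exact (ENNReal.toReal_lt_toReal (by simp) hp).2 hp1
  choose u hu hu' using fun k => IsPermutable.exists_norm_one_mul (φ (unit 𝕜 p k))
  have hcard : ∀ (ε : ℝ) (s : Finset K), (∀ k ∈ s, ε ≤ ‖φ (unit 𝕜 p k)‖) →
      s.card * ε ≤ ‖φ‖ * (s.card : ℝ) ^ (1 / p.toReal) := by
    intro ε s hs
    have h1 : ‖∑ k ∈ s, u k • unit 𝕜 p k‖ = (s.card : ℝ) ^ (1 / p.toReal) := by
      rw [one_div, Real.eq_rpow_inv (norm_nonneg _) (Nat.cast_nonneg _) hp0.ne',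
        norm_rpow_sum_smul_unit hp]
      simp [hu]
    have h2 : φ (∑ k ∈ s, u k • unit 𝕜 p k) = ((∑ k ∈ s, ‖φ (unit 𝕜 p k)‖ : ℝ) : 𝕜) := by
      rw [map_sum_smul_clm, RCLike.ofReal_sum]
      exact Finset.sum_congr rfl fun k _ => hu' k
    have h3 := φ.le_opNorm (∑ k ∈ s, u k • unit 𝕜 p k)
    rw [h2, RCLike.norm_ofReal, abs_of_nonneg (Finset.sum_nonneg fun _ _ => norm_nonneg _), h1] at h3
    refine le_trans ?_ h3
    rw [← nsmul_eq_mul]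
    exact Finset.card_nsmul_le_sum _ _ _ hs
  have hfin : ∀ ε : ℝ, 0 < ε → {k | ε ≤ ‖φ (unit 𝕜 p k)‖}.Finite := by
    intro ε hε
    by_contra hinf
    have hq : 0 < 1 - 1 / p.toReal := by
      rw [sub_pos, div_lt_one hp0]; exact hp1'
    obtain ⟨n, hn⟩ := ((tendsto_rpow_atTop hq).comp tendsto_natCast_atTop_atTop).eventually
      (eventually_gt_atTop (‖φ‖ / ε)) |>.and (eventually_ge_atTop 1) |>.exists
    obtain ⟨s, hs, rfl⟩ := Set.Infinite.exists_subset_card_eq hinf n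
    have h1 := hcard ε s fun k hk => hs hk
    have hpos : (0 : ℝ) < s.card := by exact_mod_cast hn.2
    have h2 : ‖φ‖ < (s.card : ℝ) ^ (1 - 1 / p.toReal) * ε := by
      have := hn.1
      rwa [Function.comp_apply, div_lt_iff₀ hε] at this
    have h3 : (s.card : ℝ) = (s.card : ℝ) ^ (1 - 1 / p.toReal) * (s.card : ℝ) ^ (1 / p.toReal) := by
      rw [← Real.rpow_add hpos]; simp
    have h4 : (0 : ℝ) < (s.card : ℝ) ^ (1 / p.toReal) := Real.rpow_pos_of_pos hpos _
    have h5 := mul_lt_mul_of_pos_right h2 h4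
    rw [mul_right_comm, ← h3] at h5
    linarith
  refine (Set.countable_iUnion fun n : ℕ => (hfin (1 / (n + 1)) (by positivity)).countable).mono ?_
  intro k hk
  obtain ⟨n, hn⟩ := exists_nat_one_div_lt (norm_pos_iff.2 hk)
  exact Set.mem_iUnion.2 ⟨n, hn.le⟩

/-- Bounded sets of `ℓ_p` admit finite colourings in which vectors of the same colour nearly agree
on a given finite set of coordinates. -/
theorem exists_coloring {M : Type*} {H : Set M} (hH : H.Finite) (R : ℝ) {η : ℝ} (hη : 0 < η) :
    ∃ (n : ℕ) (c : lp (fun _ : M => 𝕜) p → ℕ), (∀ z, c z < n) ∧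
      ∀ z w, ‖z‖ ≤ R → ‖w‖ ≤ R → c z = c w → ‖pullback 𝕜 p (.onSet H) (z - w)‖ ≤ η := by
  classical
  lift H to Finset M using hH
  -- Colour a vector by a nearby point of a finite net in the finite-dimensional ball. Equal colours
  -- give a difference of at most `η / (H.card + 1)` per coordinate, hence `η` in total; the added
  -- one covers empty `H`.
  have hη' : 0 < η / (2 * (H.card + 1)) := by positivity
  obtain ⟨t, htf, ht⟩ := Metric.totallyBounded_iff.1
    (isCompact_closedBall (0 : H → 𝕜) (max R 0)).totallyBounded _ hη'
  let r : lp (fun _ : M => 𝕜) p → H → 𝕜 := fun z c => z c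
  have hr : ∀ z, ‖z‖ ≤ R → ∃ y ∈ t, dist (r z) y < η / (2 * (H.card + 1)) := by
    intro z hz
    have h1 : r z ∈ Metric.closedBall (0 : H → 𝕜) (max R 0) := by
      rw [mem_closedBall_zero_iff, pi_norm_le_iff_of_nonneg (le_max_right _ _)]
      intro c
      exact ((lp.norm_apply_le_norm (zero_lt_of_fact (p := p)).ne' z c).trans hz).trans
        (le_max_left _ _)
    simpa using ht h1
  choose! y hyt hy using hr
  have hfin := htf.fintype
  let e := Fintype.equivFin t
  refine ⟨Fintype.card t + 1, fun z => if h : ‖z‖ ≤ R then e ⟨y z, hyt z h⟩ else 0, fun z => ?_,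
    fun z w hz hw hzw => ?_⟩
  · dsimp only
    split_ifs
    · exact (Fin.is_lt _).trans (Nat.lt_succ_self _)
    · exact Nat.succ_pos _
  · simp only [dif_pos hz, dif_pos hw] at hzw
    rw [Fin.val_inj, e.apply_eq_iff_eq, Subtype.mk.injEq] at hzw
    have h1 := hy z hz
    have h2 := hy w hw
    rw [← hzw] at h2
    have h3 : dist (r z) (r w) ≤ η / (H.card + 1) := by
      have h4 : η / (H.card + 1) = η / (2 * (H.card + 1)) + η / (2 * (H.card + 1)) := by
        field_simp; ring
      rw [h4]
      exact (dist_triangle_right _ _ _).trans (add_le_add h1.le h2.le)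
    refine (norm_pullback_onSet_le_sum H _).trans ?_
    calc ∑ c ∈ H, ‖(z - w) c‖ ≤ ∑ c ∈ H, η / (H.card + 1) := by
          refine Finset.sum_le_sum fun c hc => ?_
          rw [lp.coeFn_sub, Pi.sub_apply, ← dist_eq_norm]
          exact (dist_le_pi_dist (r z) (r w) ⟨c, hc⟩).trans h3
      _ = H.card * (η / (H.card + 1)) := by rw [Finset.sum_const, nsmul_eq_mul]
      _ ≤ η := by
        rw [mul_div_assoc', div_le_iff₀ (by positivity)]
        nlinarith

end lp

end LpHumps

/-! ### Singular operators on `ℓ_p` -/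

section LpSingular

namespace lp

open Cardinal

universe u

variable {𝕜 : Type*} [RCLike 𝕜] {p : ℝ≥0∞} [Fact (1 ≤ p)] {K : Type u} {M : Type*}

variable (𝕜 p) in
/-- The difference of two unit vectors. -/
noncomputable def diff (k l : K) : lp (fun _ : K => 𝕜) p := unit 𝕜 p k - unit 𝕜 p l

theorem one_le_norm_diff {k l : K} (h : k ≠ l) : 1 ≤ ‖diff 𝕜 p k l‖ := by
  have h1 : diff 𝕜 p k l k = 1 := by
    rw [diff, lp.coeFn_sub, Pi.sub_apply, unit_self, unit_of_ne h, sub_zero]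
  have h2 := lp.norm_apply_le_norm (zero_lt_of_fact (p := p)).ne' (diff 𝕜 p k l) k
  rwa [h1, norm_one] at h2

/-- Selection of differences of unit vectors whose images are nearly disjointly supported, from
a one-step extension property. -/
theorem exists_injective_of_extension [Infinite K]
    (T : lp (fun _ : K => 𝕜) p →L[𝕜] lp (fun _ : M => 𝕜) p) (Q : Set M → Prop) (E : K → ℝ)
    (hext : ∀ (i : K) (U V : Set K) (F : K → Set M), #U < #K → #V < #K → (∀ j ∈ U, Q (F j)) →
      ∃ k ∉ V, ∃ l ∉ V, k ≠ l ∧ ∃ G, Q G ∧ Disjoint (⋃ j ∈ U, F j) G ∧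
        ‖T (diff 𝕜 p k l) - pullback 𝕜 p (.onSet G) (T (diff 𝕜 p k l))‖ ≤ E i) :
    ∃ k l : K → K, Function.Injective k ∧ Function.Injective l ∧ (∀ i, k i ≠ l i) ∧
      ∃ F : K → Set M, (Pairwise fun i j => Disjoint (F i) (F j)) ∧
        ∀ i, ‖T (diff 𝕜 p (k i) (l i)) -
          pullback 𝕜 p (.onSet (F i)) (T (diff 𝕜 p (k i) (l i)))‖ ≤ E i := by
  have : Nonempty K := inferInstance
  obtain ⟨f, hf, hr⟩ := exists_pairwise_of_forall_lt (K := K) (α := K × K × Set M)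
    (fun i a => a.1 ≠ a.2.1 ∧ Q a.2.2 ∧ ‖T (diff 𝕜 p a.1 a.2.1) -
      pullback 𝕜 p (.onSet a.2.2) (T (diff 𝕜 p a.1 a.2.1))‖ ≤ E i)
    (fun a b => a.1 ≠ b.1 ∧ a.2.1 ≠ b.2.1 ∧ Disjoint a.2.2 b.2.2)
    (fun a b h => ⟨h.1.symm, h.2.1.symm, h.2.2.symm⟩) (by
      intro i U f hU hP
      have hV : #((fun j => (f j).1) '' U ∪ (fun j => (f j).2.1) '' U : Set K) < #K :=
        (mk_union_le _ _).trans_lt (add_lt_of_lt (aleph0_le_mk K)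
          (mk_image_le.trans_lt hU) (mk_image_le.trans_lt hU))
      obtain ⟨k, hk, l, hl, hkl, G, hQ, hG, hle⟩ :=
        hext i U _ (fun j => (f j).2.2) hU hV fun j hj => (hP j hj).2.1
      refine ⟨(k, l, G), ⟨hkl, hQ, hle⟩, fun j hj => ⟨?_, ?_, ?_⟩⟩
      · rintro rfl
        exact hk (Or.inl ⟨j, hj, rfl⟩)
      · rintro rfl
        exact hl (Or.inr ⟨j, hj, rfl⟩)
      · exact hG.mono_left (Set.subset_biUnion_of_mem (u := fun j => (f j).2.2) hj))
  refine ⟨fun i => (f i).1, fun i => (f i).2.1, fun i j h => ?_, fun i j h => ?_,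
    fun i => (hf i).1, fun i => (f i).2.2, fun i j h => (hr h).2.2, fun i => (hf i).2.2⟩
  · by_contra hne
    exact (hr hne).1 h
  · by_contra hne
    exact (hr hne).2.1 h

/-- Two unit vectors whose images nearly agree on a small union of finite sets. -/
theorem exists_norm_pullback_diff_le [Infinite K] (hp : p ≠ ∞)
    (T : lp (fun _ : K => 𝕜) p →L[𝕜] lp (fun _ : M => 𝕜) p) {U V : Set K} (hU : #U < #K)
    (hV : #V < #K) {F : K → Set M} (hF : ∀ j ∈ U, (F j).Finite) {η : ℝ} (hη : 0 < η) :
    ∃ k ∉ V, ∃ l ∉ V, k ≠ l ∧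
      ‖pullback 𝕜 p (.onSet (⋃ j ∈ U, F j)) (T (diff 𝕜 p k l))‖ ≤ η := by
  classical
  set G : Set M := ⋃ j ∈ U, F j with hG
  let GD : Finset U → Set M := fun D => ⋃ j ∈ D, F j
  have hGDfin : ∀ D, (GD D).Finite := fun D =>
    D.finite_toSet.biUnion fun j _ => hF j j.2
  have hGDG : ∀ D, GD D ⊆ G := by
    intro D c hc
    obtain ⟨j, _, hc⟩ := Set.mem_iUnion₂.1 hc
    exact Set.mem_iUnion₂.2 ⟨j, j.2, hc⟩
  -- Although `G` may be infinite, each image is concentrated within it on finitely many of the `F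
  -- j`, so there are fewer than `#K` colours.
  have happrox : ∀ k, ∃ D : Finset U,
      ‖pullback 𝕜 p (.onSet (G \ GD D)) (T (unit 𝕜 p k))‖ ≤ η / 4 := by
    intro k
    obtain ⟨H, hHG, hH⟩ := exists_finset_norm_pullback_le hp (T (unit 𝕜 p k)) G
      (show 0 < η / 4 by positivity)
    have hj : ∀ c : H, ∃ j : U, (c : M) ∈ F j := by
      intro c
      obtain ⟨j, hjU, hc⟩ := Set.mem_iUnion₂.1 (hHG c.2)
      exact ⟨⟨j, hjU⟩, hc⟩
    choose j hj using hj
    refine ⟨Finset.univ.image j, (norm_pullback_onSet_mono ?_ _).trans hH⟩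
    refine Set.sdiff_subset_sdiff_right fun c hc => ?_
    exact Set.mem_iUnion₂.2 ⟨j ⟨c, hc⟩, Finset.mem_image_of_mem _ (Finset.mem_univ _), hj ⟨c, hc⟩⟩
  choose D hD using happrox
  choose n c hcn hc using fun D : Finset U =>
    exists_coloring (𝕜 := 𝕜) (p := p) (hGDfin D) ‖T‖ (show 0 < η / 4 by positivity)
  obtain ⟨k, hk, l, hl, hkl, hDkl, hckl⟩ := exists_ne_of_finset_coloring hU hV D n
    (fun k => c (D k) (T (unit 𝕜 p k))) fun k => hcn _ _
  refine ⟨k, hk, l, hl, hkl, ?_⟩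
  have hTu : ∀ k, ‖T (unit 𝕜 p k)‖ ≤ ‖T‖ := fun k => by
    simpa using T.le_opNorm (unit 𝕜 p k)
  have h1 : ‖pullback 𝕜 p (.onSet (GD (D k))) (T (unit 𝕜 p k) - T (unit 𝕜 p l))‖ ≤ η / 4 :=
    hc (D k) _ _ (hTu k) (hTu l) (by rw [hckl, hDkl])
  have h2 := hD k
  have h3 := hD l
  rw [← hDkl] at h3
  have h4 : G = GD (D k) ∪ (G \ GD (D k)) := (Set.union_sdiff_cancel (hGDG _)).symm
  rw [h4, pullback_onSet_union Set.disjoint_sdiff_right, diff, map_sub]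
  refine (norm_add_le _ _).trans ?_
  rw [map_sub (pullback 𝕜 p (.onSet (G \ GD (D k))))]
  have h5 := norm_sub_le (pullback 𝕜 p (.onSet (G \ GD (D k))) (T (unit 𝕜 p k)))
    (pullback 𝕜 p (.onSet (G \ GD (D k))) (T (unit 𝕜 p l)))
  linarith

/-- Half of `η` pays for the part of the image on coordinates already used, the other half for the
tail beyond a finite set of new coordinates. -/
theorem exists_finite_extension [Infinite K] (hp : p ≠ ∞)
    (T : lp (fun _ : K => 𝕜) p →L[𝕜] lp (fun _ : M => 𝕜) p) {U V : Set K} (hU : #U < #K)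
    (hV : #V < #K) {F : K → Set M} (hF : ∀ j ∈ U, (F j).Finite) {η : ℝ} (hη : 0 < η) :
    ∃ k ∉ V, ∃ l ∉ V, k ≠ l ∧ ∃ G : Set M, G.Finite ∧ Disjoint (⋃ j ∈ U, F j) G ∧
        ‖T (diff 𝕜 p k l) - pullback 𝕜 p (.onSet G) (T (diff 𝕜 p k l))‖ ≤ η := by
  obtain ⟨k, hk, l, hl, hkl, h⟩ := exists_norm_pullback_diff_le hp T hU hV hF (half_pos hη)
  set z := T (diff 𝕜 p k l)
  set S : Set M := ⋃ j ∈ U, F j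
  obtain ⟨H, hHS, hH⟩ := exists_finset_norm_pullback_le hp z Sᶜ (half_pos hη)
  have hdisj : Disjoint S (H : Set M) := by
    rw [Set.disjoint_left]
    exact fun c hc hcH => hHS hcH hc
  refine ⟨k, hk, l, hl, hkl, H, H.finite_toSet, hdisj, ?_⟩
  have h1 : z = pullback 𝕜 p (.onSet S) z +
      (pullback 𝕜 p (.onSet (H : Set M)) z + pullback 𝕜 p (.onSet (Sᶜ \ H)) z) := by
    rw [← pullback_onSet_union Set.disjoint_sdiff_right, Set.union_sdiff_cancel hHS,
      ← pullback_onSet_union disjoint_compl_right, Set.union_compl_self, pullback_onSet_univ]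
  have h2 : z - pullback 𝕜 p (.onSet (H : Set M)) z =
      pullback 𝕜 p (.onSet S) z + pullback 𝕜 p (.onSet (Sᶜ \ H)) z := by
    rw [sub_eq_iff_eq_add]
    refine h1.trans ?_
    abel
  rw [h2]
  linarith [norm_add_le (pullback 𝕜 p (.onSet S) z) (pullback 𝕜 p (.onSet (Sᶜ \ H)) z)]

/-- Each coordinate of `T` is a functional that sees only countably many unit vectors. Fewer than
`#K` unit vectors therefore meet the used coordinates, and avoiding them makes the supports exactly
disjoint. -/
theorem exists_countable_extension [Infinite K] (hK : ℵ₀ < #K) (hp : p ≠ ∞) (hp1 : 1 < p)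
    (T : lp (fun _ : K => 𝕜) p →L[𝕜] lp (fun _ : M => 𝕜) p) {U V : Set K} (hU : #U < #K)
    (hV : #V < #K) {F : K → Set M} (hF : ∀ j ∈ U, (F j).Countable) :
    ∃ k ∉ V, ∃ l ∉ V, k ≠ l ∧ ∃ G : Set M, G.Countable ∧ Disjoint (⋃ j ∈ U, F j) G ∧
        ‖T (diff 𝕜 p k l) - pullback 𝕜 p (.onSet G) (T (diff 𝕜 p k l))‖ ≤ 0 := by
  let B : K → Set K := fun j => ⋃ c ∈ F j, {k | T (unit 𝕜 p k) c ≠ 0}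
  have hB : ∀ j ∈ U, #(B j) ≤ ℵ₀ := by
    intro j hj
    rw [le_aleph0_iff_set_countable]
    exact (hF j hj).biUnion fun c _ => countable_apply_unit_ne_zero hp hp1
      ((lp.evalCLM 𝕜 (fun _ : M => 𝕜) p c).comp T)
  have hW : #(⋃ j ∈ U, B j : Set K) < #K := by
    refine (mk_biUnion_le B U).trans_lt (mul_lt_of_lt (aleph0_le_mk K) hU ?_)
    exact (ciSup_le' fun j : U => hB j j.2).trans_lt hK
  have hVW : #(V ∪ ⋃ j ∈ U, B j : Set K) < #K :=
    (mk_union_le _ _).trans_lt (add_lt_of_lt (aleph0_le_mk K) hV hW)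
  have hinf : Infinite ((V ∪ ⋃ j ∈ U, B j)ᶜ : Set K) := by
    rw [infinite_iff, mk_compl_of_infinite _ hVW]
    exact aleph0_le_mk K
  obtain ⟨⟨k, hk⟩, ⟨l, hl⟩, hkl⟩ := exists_pair_ne ((V ∪ ⋃ j ∈ U, B j)ᶜ : Set K)
  have hzero : ∀ k ∈ (V ∪ ⋃ j ∈ U, B j)ᶜ, ∀ c ∈ ⋃ j ∈ U, F j, T (unit 𝕜 p k) c = 0 := by
    intro k hk c hc
    by_contra hne
    obtain ⟨j, hj, hc⟩ := Set.mem_iUnion₂.1 hc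
    exact hk (Or.inr (Set.mem_iUnion₂.2 ⟨j, hj, Set.mem_iUnion₂.2 ⟨c, hc, hne⟩⟩))
  refine ⟨k, fun h => hk (Or.inl h), l, fun h => hl (Or.inl h), fun h => hkl (Subtype.ext h),
    {c | T (diff 𝕜 p k l) c ≠ 0}, countable_support hp _, ?_, ?_⟩
  · rw [Set.disjoint_left]
    intro c hc h
    refine h ?_
    rw [diff, map_sub, lp.coeFn_sub, Pi.sub_apply, hzero k hk c hc, hzero l hl c hc, sub_zero]
  · rw [norm_le_zero_iff, sub_eq_zero]
    ext c
    by_cases h : T (diff 𝕜 p k l) c = 0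
    · rw [pullback_onSet_apply_of_notMem (F := {c | T (diff 𝕜 p k l) c ≠ 0}) _
        (fun h' => h' h), h]
    · rw [pullback_onSet_apply_of_mem _ (show c ∈ {c | T (diff 𝕜 p k l) c ≠ 0} from h)]

/-- Every operator between `ℓ_p` spaces maps some full family of differences of unit vectors to
small perturbations of disjointly supported vectors. -/
theorem exists_nearly_disjoint [Infinite K] (hp : p ≠ ∞)
    (T : lp (fun _ : K => 𝕜) p →L[𝕜] lp (fun _ : M => 𝕜) p) {ε : ℝ} (hε : 0 < ε) :
    ∃ k l : K → K, Function.Injective k ∧ Function.Injective l ∧ (∀ i, k i ≠ l i) ∧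
      ∃ (F : K → Set M) (E : K → ℝ), (Pairwise fun i j => Disjoint (F i) (F j)) ∧
        (∀ (x : lp (fun _ : K => 𝕜) p) (s : Finset K), ∑ i ∈ s, ‖x i‖ * E i ≤ ε * ‖x‖) ∧
        ∀ i, ‖T (diff 𝕜 p (k i) (l i)) -
          pullback 𝕜 p (.onSet (F i)) (T (diff 𝕜 p (k i) (l i)))‖ ≤ E i := by
  obtain ⟨Q, E, hE, hext⟩ : ∃ (Q : Set M → Prop) (E : K → ℝ),
      (∀ (x : lp (fun _ : K => 𝕜) p) (s : Finset K), ∑ i ∈ s, ‖x i‖ * E i ≤ ε * ‖x‖) ∧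
      ∀ (i : K) (U V : Set K) (F : K → Set M), #U < #K → #V < #K → (∀ j ∈ U, Q (F j)) →
        ∃ k ∉ V, ∃ l ∉ V, k ≠ l ∧ ∃ G, Q G ∧ Disjoint (⋃ j ∈ U, F j) G ∧
          ‖T (diff 𝕜 p k l) - pullback 𝕜 p (.onSet G) (T (diff 𝕜 p k l))‖ ≤ E i := by
    have hp1 : 1 ≤ p := Fact.out
    rcases (aleph0_le_mk K).eq_or_lt with hK | hK
    · have hcount : Countable K := mk_le_aleph0_iff.1 hK.ge
      have henc : Encodable K := Encodable.ofCountable K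
      obtain ⟨E, hE0, a, haE, haε⟩ := posSumOfEncodable hε K
      refine ⟨Set.Finite, E, fun x s => ?_, fun i U V F hU hV hF =>
        exists_finite_extension hp T hU hV hF (hE0 i)⟩
      calc ∑ i ∈ s, ‖x i‖ * E i ≤ ∑ i ∈ s, ‖x‖ * E i := by
            refine Finset.sum_le_sum fun i _ => mul_le_mul_of_nonneg_right ?_ (hE0 i).le
            exact lp.norm_apply_le_norm (zero_lt_of_fact (p := p)).ne' x i
        _ = ‖x‖ * ∑ i ∈ s, E i := by rw [Finset.mul_sum]
        _ ≤ ‖x‖ * ε := by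
            gcongr
            exact (sum_le_hasSum s (fun i _ => (hE0 i).le) haE).trans haε
        _ = ε * ‖x‖ := mul_comm _ _
    · rcases hp1.eq_or_lt with rfl | hp1
      -- For `p = 1` a constant error suffices, since the `ℓ_1` norm controls the sum of the
      -- coefficients.
      · refine ⟨Set.Finite, fun _ => ε, fun x s => ?_, fun i U V F hU hV hF =>
          exists_finite_extension hp T hU hV hF hε⟩
        rw [← Finset.sum_mul, mul_comm]
        gcongr
        simpa using lp.sum_rpow_le_norm_rpow (p := 1) (by simp) x s
      · exact ⟨Set.Countable, fun _ => 0, fun x s => by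
          simpa using mul_nonneg hε.le (norm_nonneg x), fun i U V F hU hV hF =>
          exists_countable_extension hK hp hp1 T hU hV hF⟩
  obtain ⟨k, l, hk, hl, hkl, F, hF, hT⟩ := exists_injective_of_extension T Q E hext
  exact ⟨k, l, hk, hl, hkl, F, E, hF, hE, hT⟩

variable {L : Type*}

theorem boundedBelowOnCopy_of_nearly_disjoint (hp : p ≠ ∞)
    (T : lp (fun _ : K => 𝕜) p →L[𝕜] lp (fun _ : M => 𝕜) p) {k l : K → K}
    (hk : Function.Injective k) (hl : Function.Injective l) {F : K → Set M} {E : K → ℝ}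
    (hF : Pairwise fun i j => Disjoint (F i) (F j)) {ε δ : ℝ} (hε : 0 ≤ ε)
    (hE : ∀ (x : lp (fun _ : K => 𝕜) p) (s : Finset K), ∑ i ∈ s, ‖x i‖ * E i ≤ ε * ‖x‖)
    (hT : ∀ i, ‖T (diff 𝕜 p (k i) (l i)) -
          pullback 𝕜 p (.onSet (F i)) (T (diff 𝕜 p (k i) (l i)))‖ ≤ E i)
    (f : L → M) (hf : Function.Injective f) (A : lp (fun _ : K => 𝕜) p →L[𝕜] lp (fun _ : L => 𝕜) p)
    (hA : ∀ x, A x = pullback 𝕜 p (.ofInjective f hf) (T x)) (g : K → K)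
    (hg : Function.Injective g) (hδ : 2 * ε < δ)
    (hAg : ∀ i, δ ≤ ‖A (diff 𝕜 p (k (g i)) (l (g i)))‖) :
    BoundedBelowOnCopy (𝕜 := 𝕜) (lp (fun _ : K => 𝕜) p) A := by
  -- Only boundedness of `J` is needed: the lower bound for `A ∘ J` comes from the disjointness of
  -- the images.
  let J : lp (fun _ : K => 𝕜) p →L[𝕜] lp (fun _ : K => 𝕜) p :=
    pullback 𝕜 p (PEquiv.ofInjective (k ∘ g) (hk.comp hg)).symm -
      pullback 𝕜 p (PEquiv.ofInjective (l ∘ g) (hl.comp hg)).symm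
  have hJ : ∀ i, J (unit 𝕜 p i) = diff 𝕜 p (k (g i)) (l (g i)) := by
    intro i
    change pullback 𝕜 p (PEquiv.ofInjective (k ∘ g) (hk.comp hg)).symm (unit 𝕜 p i) -
      pullback 𝕜 p (PEquiv.ofInjective (l ∘ g) (hl.comp hg)).symm (unit 𝕜 p i) = _
    rw [pullback_symm_unit, pullback_symm_unit]
    rfl
  refine boundedBelowOnCopy_of_comp J A (sub_pos.2 hδ) fun x => ?_
  refine mul_norm_le_of_disjoint hp (A.comp J) (fun i => f ⁻¹' F (g i))
    (fun i j hij => (hF (hg.ne hij)).preimage f) (fun i => E (g i)) (by linarith)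
    (fun x s => ?_) (fun i => ?_) (fun i => ?_) x
  · have h1 := hE (pullback 𝕜 p (PEquiv.ofInjective g hg).symm x) (s.map ⟨g, hg⟩)
    rw [norm_pullback_symm, Finset.sum_map] at h1
    simpa only [Function.Embedding.coeFn_mk, pullback_symm_apply] using h1
  · rw [ContinuousLinearMap.comp_apply, hJ]
    exact hAg i
  · rw [ContinuousLinearMap.comp_apply, hJ, hA]
    have h1 : pullback 𝕜 p (.onSet (f ⁻¹' F (g i))) (pullback 𝕜 p (.ofInjective f hf)
        (T (diff 𝕜 p (k (g i)) (l (g i))))) = pullback 𝕜 p (.ofInjective f hf)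
          (pullback 𝕜 p (.onSet (F (g i))) (T (diff 𝕜 p (k (g i)) (l (g i))))) := by
      ext c
      rw [pullback_ofInjective_apply]
      by_cases h : f c ∈ F (g i)
      · rw [pullback_onSet_apply_of_mem _ h, pullback_onSet_apply_of_mem _ (Set.mem_preimage.2 h),
          pullback_ofInjective_apply]
      · rw [pullback_onSet_apply_of_notMem _ h,
          pullback_onSet_apply_of_notMem _ (show c ∉ f ⁻¹' F (g i) from h)]
    rw [h1, ← map_sub]
    exact (norm_pullback_le _ _).trans (hT (g i))

theorem isClosedIdeal_singularOps [Infinite K] (hp : p ≠ ∞) :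
    IsClosedIdeal (singularOps 𝕜 (lp (fun _ : K => 𝕜) p) (lp (fun _ : L => 𝕜) p)) := by
  have : Nontrivial (lp (fun _ : K => 𝕜) p) := by
    refine ⟨⟨unit 𝕜 p (Classical.arbitrary K), 0, fun h => ?_⟩⟩
    have h1 := norm_unit (𝕜 := 𝕜) (p := p) (Classical.arbitrary K)
    rw [h] at h1
    simp at h1
  refine _root_.isClosedIdeal_singularOps fun A B c hc hAB => ?_
  have hinl : Function.Injective (Sum.inl : L → L ⊕ L) := Sum.inl_injective
  have hinr : Function.Injective (Sum.inr : L → L ⊕ L) := Sum.inr_injective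
  -- A single operator carrying both summands, so that one choice of differences serves `A` and `B`.
  let T : lp (fun _ : K => 𝕜) p →L[𝕜] lp (fun _ : L ⊕ L => 𝕜) p :=
    (pullback 𝕜 p (PEquiv.ofInjective _ hinl).symm).comp A +
      (pullback 𝕜 p (PEquiv.ofInjective _ hinr).symm).comp B
  have hT : ∀ x d, T x d = pullback 𝕜 p (PEquiv.ofInjective _ hinl).symm (A x) d +
    pullback 𝕜 p (PEquiv.ofInjective _ hinr).symm (B x) d := fun x d => rfl
  have hTA : ∀ x, A x = pullback 𝕜 p (.ofInjective _ hinl) (T x) := by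
    intro x
    ext d
    rw [pullback_ofInjective_apply, hT, pullback_symm_apply,
      pullback_symm_apply_of_notMem _ _ _ (by simp), add_zero]
  have hTB : ∀ x, B x = pullback 𝕜 p (.ofInjective _ hinr) (T x) := by
    intro x
    ext d
    rw [pullback_ofInjective_apply, hT, pullback_symm_apply,
      pullback_symm_apply_of_notMem _ _ _ (by simp), zero_add]
  obtain ⟨k, l, hk, hl, hkl, F, E, hF, hE, hTF⟩ :=
    -- With `δ = c / 2` the requirement is `2 * ε < δ`, and `ε = c / 8` meets it.
    exists_nearly_disjoint hp T (show 0 < c / 8 by positivity)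
  obtain ⟨g, hg, h⟩ := exists_injective_forall_or
    (P := fun i => c / 2 ≤ ‖A (diff 𝕜 p (k i) (l i))‖)
    (Q := fun i => c / 2 ≤ ‖B (diff 𝕜 p (k i) (l i))‖) (by
      intro i
      by_contra! h
      have h1 := hAB (diff 𝕜 p (k i) (l i))
      have h2 := one_le_norm_diff (𝕜 := 𝕜) (p := p) (hkl i)
      have h3 := norm_add_le (A (diff 𝕜 p (k i) (l i))) (B (diff 𝕜 p (k i) (l i)))
      nlinarith [h.1, h.2])
  refine h.imp (fun h => ?_) fun h => ?_
  · exact boundedBelowOnCopy_of_nearly_disjoint hp T hk hl hF (by positivity) hE hTF _ hinl A hTA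
      g hg (by linarith) h
  · exact boundedBelowOnCopy_of_nearly_disjoint hp T hk hl hF (by positivity) hE hTF _ hinr B hTB
      g hg (by linarith) h

end lp

end LpSingular

/-! ### The main theorem -/

theorem theorem3 (𝕜 : Type*) [RCLike 𝕜] (K L : Type*) [Infinite K] [Infinite L] :
    IsClosedIdeal (singularOps 𝕜 (c0Space 𝕜 K) (c0Space 𝕜 L)) ∧
    (∀ (p : ℝ≥0∞) [Fact (1 ≤ p)],
      IsClosedIdeal (singularOps 𝕜 (lp (fun _ : K => 𝕜) p) (lp (fun _ : L => 𝕜) p))) ∧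
    IsClosedIdeal (singularOps 𝕜 (linftyc 𝕜 K) (linftyc 𝕜 L)) ∧
    singularOps 𝕜 (linftyc 𝕜 K) (linftyc 𝕜 L) =
      singularOps 𝕜 (c0Space 𝕜 K) (linftyc 𝕜 L) := by
  refine ⟨isPermutable_c0Space.isClosedIdeal_singularOps, fun p _ => ?_,
    isPermutable_linftyc.isClosedIdeal_singularOps,
    Set.ext fun T => not_congr (boundedBelowOnCopy_linftyc_iff T)⟩
  by_cases hp : p = ∞
  · subst hp
    exact isClosedIdeal_singularOps_lp_top
  · exact lp.isClosedIdeal_singularOps hp
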